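/- Let $\alpha\in(1,2)$, $\beta=\alpha/2$, $L>0$, $\Omega=(0,L)$. Let $\lambda_k=(k\pi/L)^2$ and $\varphi_k(x)=\sqrt{2/L}\,\sin(k\pi x/L)$, $k\ge 1$, be the Dirichlet eigenvalues and orthonormal eigenfunctions of $-\Delta=-\partial_x^2$ on $\Omega$; for $s>0$ put $$\mathcal D((-\Delta)^s)=\Big\{w\in L^2(\Omega):\ \sum_{k\ge1}|\lambda_k^{s}(w,\varphi_k)|^2<\infty\Big\},\qquad (-\Delta)^s w=\sum_{k\ge1}\lambda_k^s(w,\varphi_k)\varphi_k .$$ In particular $\mathcal D((-\Delta)^{1/2})=H^1_0(\Omega)$. Let $\omega_\mu(t)=t^{\mu-1}/\Gamma(\mu)$ and let $\partial_t^\beta h(t)=\int_0^t\omega_{1-\beta}(t-s)h'(s)\,ds$ be the Caputo derivative. Let $\gamma\in(\frac1\alpha+\frac12,\frac32]$. There is a constant $C>0$, depending only on $\alpha,\gamma,L$, such that the following holds for all $T>0$, all $a_0\in\mathcal D((-\Delta)^\gamma)$ and all $a_1,f\in H^1_0(\Omega)=\mathcal D((-\Delta)^{1/2})$. Let $(u,v)$,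 with $u(\cdot,t),v(\cdot,t)\in L^2(\Omega)$, be a solution of $$\begin{cases}\partial_t^\beta v-u_{xx}=a_1(x)\,\omega_{2-\alpha}(t)+t^{1-\alpha}f(x), & (x,t)\in\Omega\times(0,T),\\ v=\partial_t^\beta u, & (x,t)\in\Omega\times(0,T),\\ u(x,0)=a_0(x),\quad v(x,0)=0, & x\in\Omega,\\ u(x,t)=v(x,t)=0, & (x,t)\in\partial\Omega\times(0,T),\end{cases}$$ in the following sense: the initial conditions hold in $L^2(\Omega)$, and for every $\psi\in C^\infty([0,L])$ with $\psi(0)=\psi(L)=0$ the functions $(u(t),\psi)$ and $(v(t),\psi)$ are absolutely continuous on $[0,t_1]$ for every $t_1<T$ and satisfy, for almost every $t\in(0,T)$, $$\partial_t^\beta (v(t),\psi)-(u(t),\psi'')=\omega_{2-\alpha}(t)(a_1,\psi)+t^{1-\alpha}(f,\psi),\qquad (v(t),\psi)=\partial_t^\beta(u(t),\psi).$$ Then $v(t)\in\mathcal D((-\Delta)^{1/2})$ for all $t\in(0,T)$, the map $t\mapsto(-\Delta)^{1/2}v(t)$ is three times continuously differentiable from $(0,T)$ to $L^2(\Omega)$,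 and for $m=0,1,2,3$ and all $t\in(0,T)$ $$\|\partial_t^m(-\Delta)^{1/2}v(t)\|_{L^2(\Omega)}\le C\,t^{1-\beta-m}\Big(\|(-\Delta)^{\gamma}a_0\|_{L^2(\Omega)}+\|(-\Delta)^{1/2}a_1\|_{L^2(\Omega)}+\|(-\Delta)^{1/2}f\|_{L^2(\Omega)}\Big).$$ -/

import Mathlib

open MeasureTheory Set
open scoped ContDiff

noncomputable section

namespace DiffusionWave

/-- The real Hilbert space `L²(Ω)`, `Ω = (0, L)`. -/
abbrev L2 (L : ℝ) : Type := Lp ℝ 2 (volume.restrict (Ioo (0 : ℝ) L))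

/-- The Dirichlet eigenvalues `(k π / L)²`, `k = 1, 2, …`, of `-d²/dx²` on `(0, L)`;
the index `n = 0, 1, 2, …` stands for `k = n + 1`. -/
def eigenval (L : ℝ) (n : ℕ) : ℝ := (((n : ℝ) + 1) * Real.pi / L) ^ 2

/-- The `L²`-normalized Dirichlet eigenfunctions `√(2 / L) sin (k π x / L)`, with `k = n + 1`. -/
def eigenfun (L : ℝ) (n : ℕ) (x : ℝ) : ℝ :=
  Real.sqrt (2 / L) * Real.sin (((n : ℝ) + 1) * Real.pi / L * x)

theorem memLp_eigenfun (L : ℝ) (n : ℕ) :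
    MemLp (eigenfun L n) 2 (volume.restrict (Ioo (0 : ℝ) L)) := by
  have hc : Continuous (eigenfun L n) := by unfold eigenfun; fun_prop
  refine MemLp.of_bound hc.aestronglyMeasurable (Real.sqrt (2 / L)) (ae_of_all _ fun x => ?_)
  rw [eigenfun, Real.norm_eq_abs, abs_mul, abs_of_nonneg (Real.sqrt_nonneg _)]
  exact mul_le_of_le_one_right (Real.sqrt_nonneg _) (Real.abs_sin_le_one _)

/-- The eigenfunctions as elements of `L²(0, L)`. -/
def eigenvec (L : ℝ) (n : ℕ) : L2 L := (memLp_eigenfun L n).toLp (eigenfun L n)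

/-- The pairing `(w, ψ) = ∫_0^L w ψ dx` of `w ∈ L²(0, L)` with a function `ψ`. -/
def pair {L : ℝ} (w : L2 L) (ψ : ℝ → ℝ) : ℝ := ∫ x in Ioo (0 : ℝ) L, w x * ψ x

/-- The domain `D((-Δ)^s) ⊆ L²(0, L)` : all `w` with `∑ |λ_k^s (w, φ_k)|² < ∞`. -/
def fracDomain (L s : ℝ) : Set (L2 L) :=
  {w | Summable fun n : ℕ => |eigenval L n ^ s * pair w (eigenfun L n)| ^ 2}

/-- The fractional power `(-Δ)^s w = ∑ λ_k^s (w, φ_k) φ_k` of the Dirichlet Laplacian; the series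
converges in `L²(0, L)` for `w ∈ D((-Δ)^s)`, and only such `w` are of interest. -/
def fracLaplacian (L s : ℝ) (w : L2 L) : L2 L :=
  ∑' n : ℕ, (eigenval L n ^ s * pair w (eigenfun L n)) • eigenvec L n

/-- The kernel `ω_μ(t) = t^(μ - 1) / Γ(μ)`. -/
def omegaKer (μ t : ℝ) : ℝ := t ^ (μ - 1) / Real.Gamma μ

/-- The Caputo derivative of order `β ∈ (0, 1)`:
`∂_t^β h (t) = ∫_0^t ω_{1-β}(t - s) h'(s) ds = 1 / Γ(1 - β) ∫_0^t (t - s)^(-β) h'(s) ds`.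
For `h` absolutely continuous on bounded intervals, `h'` exists almost everywhere and is integrable,
and the integral converges for almost every `t`. -/
def caputo (β : ℝ) (h : ℝ → ℝ) (t : ℝ) : ℝ :=
  ∫ s in (0 : ℝ)..t, omegaKer (1 - β) (t - s) * deriv h s

/-- `h` is absolutely continuous on `[0, t]` for every `t ∈ (0, T)`. -/
def LocallyAC (T : ℝ) (h : ℝ → ℝ) : Prop :=
  ∀ t ∈ Ioo (0 : ℝ) T, AbsolutelyContinuousOnInterval h 0 t

/-- `(u, v)` is a (weak in space) solution, with `β = α / 2`, of the system

* `∂_t^β v - u_xx = ω_{2-α}(t) a₁(x) + t^(1-α) f(x)` in `(0, L) × (0, T)`,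
* `v = ∂_t^β u` in `(0, L) × (0, T)`,
* `u(·, 0) = a₀`, `v(·, 0) = 0` in `(0, L)`,
* `u = v = 0` on `{0, L} × (0, T)`.

The equations are tested with smooth `ψ` on `[0, L]` that vanish at `0` and `L`, and both
derivatives in `x` are moved to `ψ`. As `ψ'` is arbitrary at `0` and `L`, this also encodes
the boundary condition for `u`, hence the one for `v`: if `u(·, t)` is of class `C²` up to the
boundary, then `-∫ u ψ'' = -∫ u_xx ψ - [u ψ']_0^L`. No regularity in `x` beyond `L²`, and no
differentiability in time of `u` and `v` as `L²`-valued functions, is presupposed. -/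
structure IsSolution (α L T : ℝ) (a₀ a₁ f : L2 L) (u v : ℝ → L2 L) : Prop where
  init_u : u 0 = a₀
  init_v : v 0 = 0
  ac_u : ∀ ψ : ℝ → ℝ, ContDiff ℝ ∞ ψ → ψ 0 = 0 → ψ L = 0 → LocallyAC T fun t => pair (u t) ψ
  ac_v : ∀ ψ : ℝ → ℝ, ContDiff ℝ ∞ ψ → ψ 0 = 0 → ψ L = 0 → LocallyAC T fun t => pair (v t) ψ
  eq_u : ∀ ψ : ℝ → ℝ, ContDiff ℝ ∞ ψ → ψ 0 = 0 → ψ L = 0 →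
    ∀ᵐ t ∂volume.restrict (Ioo (0 : ℝ) T),
      pair (v t) ψ = caputo (α / 2) (fun s => pair (u s) ψ) t
  eq_v : ∀ ψ : ℝ → ℝ, ContDiff ℝ ∞ ψ → ψ 0 = 0 → ψ L = 0 →
    ∀ᵐ t ∂volume.restrict (Ioo (0 : ℝ) T),
      caputo (α / 2) (fun s => pair (v s) ψ) t - pair (u t) (deriv (deriv ψ)) =
        omegaKer (2 - α) t * pair a₁ ψ + t ^ (1 - α) * pair f ψ

end DiffusionWave

end

noncomputable section

namespace DiffusionWave

/-! Testing with an eigenfunction decouples the system. With `l` an eigenvalue, `a` the coefficient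
of `a₀` and `b` that of `a₁ + Γ(2-α) f`, applying the fractional integral of order `α/2` to both
equations and eliminating `u` leaves the Volterra equation `V = -l a ω_{α/2+1} + b ω_{2-α/2} - l I^α
V` (`volterra_of_caputo`). Its Neumann series converges to `V`, which gives uniqueness and an
explicit solution (`volterra_iterate`, `tendsto_volterra_remainder`).

The sum of that series is a Laplace inversion integral with symbol `(-l a s^(α/2-1) + b s^(3α/2-2))
/ (s^α + l)`. The contour consists of two conjugate rays from `0` with directions `±θ`, where `π/2 <
θ < π/α`. The exponential decays on them and the poles, at arguments `±π/α`, stay to their left. The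
symbol is real on the positive axis, so the integral is `1/π` times the imaginary part of the
integral over the upper ray alone. Hankel's formula and a geometric expansion identify the integral
with the series (`hankel`, `tendsto_mittagLeffler`).

On the ray, `|s^α + l|` is comparable to `|s|^α + l` (`cos_mul_le_norm_cpow_add`). The weighted
inequality of the means, `r l^(1-1/α) ≤ r^α + l`, then bounds the symbol by a multiple of
`(l^(1/α)|a| + |b|) r^(α/2-2)` with a factor independent of `l` (`norm_modeSymbol_le`). Integration
against `r^m exp(-t|cos θ| r)` produces the power `t^(1-α/2-m)` for `m ≥ 1`. For `m = 0` the
integral of this majorant diverges at the origin, and the bound follows from the case `m = 1` by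
integration in time from `v(0) = 0` (`IsSolution.abs_mode_le`).

After multiplication by `l^(1/2)`, the modes and all their derivatives are dominated by one sequence
times functions of `t`. Since `γ > 1/α + 1/2`, the data norms control the square sum of this
sequence (`exists_majorant_le`). Parseval's identity gives the estimate, and termwise
differentiation of the orthogonal series gives the regularity (`Orthonormal.hasDerivAt_tsum_smul`).
-/

/-! ### Power kernels and the semigroup of Riemann-Liouville integrals -/

theorem omegaKer_nonneg {a x : ℝ} (ha : 0 < a) (hx : 0 ≤ x) : 0 ≤ omegaKer a x :=
  div_nonneg (Real.rpow_nonneg hx _) (Real.Gamma_pos_of_pos ha).le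

theorem omegaKer_pos {a x : ℝ} (ha : 0 < a) (hx : 0 < x) : 0 < omegaKer a x :=
  div_pos (Real.rpow_pos_of_pos hx _) (Real.Gamma_pos_of_pos ha)

theorem measurable_omegaKer (a : ℝ) : Measurable (omegaKer a) := by
  unfold omegaKer; fun_prop

theorem omegaKer_le_of_le {a x t : ℝ} (ha : 1 ≤ a) (hx : 0 ≤ x) (hxt : x ≤ t) :
    omegaKer a x ≤ omegaKer a t := by
  unfold omegaKer
  have := Real.Gamma_pos_of_pos (by linarith : 0 < a)
  gcongr

/-- Euler's Beta integral, scaled to `(0, t)`; the Gamma factors in the kernels cancel the Beta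
value. -/
theorem integral_omegaKer_mul_omegaKer_zero {a b t : ℝ} (ha : 0 < a) (hb : 0 < b) (ht : 0 < t) :
    ∫ s in (0 : ℝ)..t, omegaKer a (t - s) * omegaKer b s = omegaKer (a + b) t := by
  have h := Complex.betaIntegral_scaled b a ht
  have h2 := Complex.Gamma_mul_Gamma_eq_betaIntegral (s := b) (t := a) (by simpa) (by simpa)
  have h3 : ∫ s in (0 : ℝ)..t, (s : ℂ) ^ ((b : ℂ) - 1) * ((t : ℂ) - s) ^ ((a : ℂ) - 1) =
      ((∫ s in (0 : ℝ)..t, s ^ (b - 1) * (t - s) ^ (a - 1) : ℝ) : ℂ) := by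
    rw [← intervalIntegral.integral_ofReal]
    refine intervalIntegral.integral_congr fun s hs => ?_
    rw [uIcc_of_le ht.le] at hs
    rw [Complex.ofReal_mul, Complex.ofReal_cpow hs.1, Complex.ofReal_cpow (by linarith [hs.2])]
    push_cast
    rfl
  have hpos : (0 : ℝ) < Real.Gamma (b + a) := Real.Gamma_pos_of_pos (by linarith)
  have key : (∫ s in (0 : ℝ)..t, s ^ (b - 1) * (t - s) ^ (a - 1)) * Real.Gamma (b + a) =
      t ^ (b + a - 1) * (Real.Gamma b * Real.Gamma a) := by
    apply Complex.ofReal_injective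
    push_cast
    rw [← h3, h, ← Complex.Gamma_ofReal, ← Complex.Gamma_ofReal, ← Complex.Gamma_ofReal, h2,
      Complex.ofReal_cpow ht.le]
    push_cast
    ring
  have : ∀ s, omegaKer a (t - s) * omegaKer b s =
      (Real.Gamma b * Real.Gamma a)⁻¹ * (s ^ (b - 1) * (t - s) ^ (a - 1)) := by
    intro s; simp only [omegaKer]; field_simp
  simp_rw [this]
  have hb' := Real.Gamma_pos_of_pos hb
  have ha' := Real.Gamma_pos_of_pos ha
  rw [intervalIntegral.integral_const_mul, omegaKer, add_comm a b, eq_div_iff hpos.ne', mul_assoc,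
    key]
  field_simp

theorem integral_omegaKer_mul_omegaKer {a b r t : ℝ} (ha : 0 < a) (hb : 0 < b) (hr : r < t) :
    ∫ s in r..t, omegaKer a (t - s) * omegaKer b (s - r) = omegaKer (a + b) (t - r) := by
  rw [← integral_omegaKer_mul_omegaKer_zero ha hb (sub_pos.2 hr)]
  have := intervalIntegral.integral_comp_sub_right (a := r) (b := t)
    (fun s => omegaKer a (t - r - s) * omegaKer b s) r
  simp only [sub_self] at this
  rw [← this]
  congr 1 with s
  congr 2
  ring

theorem intervalIntegrable_omegaKer_mul_omegaKer {a b r t : ℝ} (ha : 0 < a) (hb : 0 < b)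
    (hr : r < t) :
    IntervalIntegrable (fun s => omegaKer a (t - s) * omegaKer b (s - r)) volume r t := by
  -- A non-integrable function has integral `0` by convention, so the positive value of the Beta
  -- integral already proves integrability.
  apply intervalIntegral.intervalIntegrable_of_integral_ne_zero
  rw [integral_omegaKer_mul_omegaKer ha hb hr]
  exact (omegaKer_pos (by linarith) (by linarith)).ne'

theorem intervalIntegrable_omegaKer {a t : ℝ} (ha : 0 < a) :
    IntervalIntegrable (omegaKer a) volume 0 t := by
  unfold omegaKer
  exact (intervalIntegral.intervalIntegrable_rpow' (by linarith)).div_const _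

/-- The Riemann-Liouville integral of order `a`. -/
def fracInt (a : ℝ) (f : ℝ → ℝ) (t : ℝ) : ℝ := ∫ s in (0 : ℝ)..t, omegaKer a (t - s) * f s

theorem fracInt_omegaKer {a b t : ℝ} (ha : 0 < a) (hb : 0 < b) (ht : 0 < t) :
    fracInt a (omegaKer b) t = omegaKer (a + b) t :=
  integral_omegaKer_mul_omegaKer_zero ha hb ht

theorem intervalIntegrable_omegaKer_sub_mul {a t : ℝ} {f : ℝ → ℝ} (ha : 1 ≤ a) (ht : 0 ≤ t)
    (hf : IntervalIntegrable f volume 0 t) :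
    IntervalIntegrable (fun s => omegaKer a (t - s) * f s) volume 0 t := by
  rw [intervalIntegrable_iff_integrableOn_Ioc_of_le ht] at hf ⊢
  refine Integrable.bdd_mul (c := omegaKer a t) hf ?_ ?_
  · exact ((measurable_omegaKer a).comp (measurable_const.sub measurable_id)).aestronglyMeasurable
  · filter_upwards [ae_restrict_mem measurableSet_Ioc] with s hs
    rw [Real.norm_eq_abs, abs_of_nonneg (omegaKer_nonneg (by linarith) (by linarith [hs.2]))]
    exact omegaKer_le_of_le ha (by linarith [hs.2]) (by linarith [hs.1])

/-- Fubini on the triangle `r < s < t` and the Beta integral. Since `a + b ≥ 1`, the composed kernel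
is bounded on `(0, t]`, so the double integral converges absolutely for every `t`, and the identity
holds pointwise rather than almost everywhere. -/
theorem fracInt_fracInt {a b t : ℝ} {f : ℝ → ℝ} (ha : 0 < a) (hb : 0 < b) (hab : 1 ≤ a + b)
    (ht : 0 < t) (hf : IntervalIntegrable f volume 0 t) :
    IntervalIntegrable (fun s => omegaKer a (t - s) * fracInt b f s) volume 0 t ∧
    fracInt a (fracInt b f) t = fracInt (a + b) f t := by
  set ν : Measure ℝ := volume.restrict (Ioc 0 t) with hν
  have hfi : Integrable f ν := (intervalIntegrable_iff_integrableOn_Ioc_of_le ht.le).1 hf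
  -- The integrand on the triangle, extended by zero so that Fubini applies to the full square.
  set Φ : ℝ → ℝ → ℝ := fun s r =>
    ({p : ℝ × ℝ | p.2 < p.1}.indicator (fun p => omegaKer a (t - p.1) * omegaKer b (p.1 - p.2)))
      (s, r) * f r with hΦ
  have hmeas : MeasurableSet {p : ℝ × ℝ | p.2 < p.1} := measurableSet_lt measurable_snd measurable_fst
  have hval : ∀ s r, Φ s r = (if r < s then omegaKer a (t - s) * omegaKer b (s - r) else 0) * f r := by
    intro s r; simp [hΦ, indicator]
  -- integrating out `s`
  have hker : ∀ r, r ∈ Ioo 0 t →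
      IntegrableOn (fun s => if r < s then omegaKer a (t - s) * omegaKer b (s - r) else 0)
        (Ioc 0 t) ∧
      ∫ s in Ioc 0 t, (if r < s then omegaKer a (t - s) * omegaKer b (s - r) else 0) =
        omegaKer (a + b) (t - r) := by
    intro r hr
    have e : (fun s => if r < s then omegaKer a (t - s) * omegaKer b (s - r) else 0) =
        (Ioi r).indicator (fun s => omegaKer a (t - s) * omegaKer b (s - r)) := by
      ext s; simp [indicator]
    have e2 : Ioc 0 t ∩ Ioi r = Ioc r t := by
      ext s; simp only [mem_inter_iff, mem_Ioc, mem_Ioi]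
      constructor
      · rintro ⟨⟨_, h⟩, h'⟩; exact ⟨h', h⟩
      · rintro ⟨h', h⟩; exact ⟨⟨hr.1.trans h', h⟩, h'⟩
    rw [e]
    constructor
    · rw [IntegrableOn, integrable_indicator_iff measurableSet_Ioi, IntegrableOn,
        Measure.restrict_restrict measurableSet_Ioi, inter_comm, e2]
      exact (intervalIntegrable_iff_integrableOn_Ioc_of_le hr.2.le).1
        (intervalIntegrable_omegaKer_mul_omegaKer ha hb hr.2)
    · rw [setIntegral_indicator measurableSet_Ioi, e2, ← intervalIntegral.integral_of_le hr.2.le]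
      exact integral_omegaKer_mul_omegaKer ha hb hr.2
  have hae : ∀ᵐ r ∂ν, r ∈ Ioo 0 t := by
    rw [hν, ← Measure.restrict_congr_set (Ioo_ae_eq_Ioc (μ := volume) (a := (0:ℝ)) (b := t))]
    exact ae_restrict_mem measurableSet_Ioo
  have hint : Integrable (Function.uncurry Φ) (ν.prod ν) := by
    rw [integrable_prod_iff']
    · constructor
      · filter_upwards [hae] with r hr
        simp only [Function.uncurry, hval]
        exact (hker r hr).1.mul_const _
      · have h1 : Integrable (fun r => ‖omegaKer (a + b) (t - r) * f r‖) ν :=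
          ((intervalIntegrable_iff_integrableOn_Ioc_of_le ht.le).1
            (intervalIntegrable_omegaKer_sub_mul hab ht.le hf)).norm
        refine h1.congr ?_
        filter_upwards [hae] with r hr
        have : ∀ᵐ s ∂ν, ‖Function.uncurry Φ (s, r)‖ =
            (if r < s then omegaKer a (t - s) * omegaKer b (s - r) else 0) * ‖f r‖ := by
          filter_upwards [hae] with s hs
          simp only [Function.uncurry, hval, norm_mul]
          congr 1
          rw [Real.norm_eq_abs, abs_of_nonneg]
          split_ifs with h
          · exact mul_nonneg (omegaKer_nonneg ha (by linarith [hs.2]))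
              (omegaKer_nonneg hb (by linarith))
          · exact le_rfl
        rw [integral_congr_ae this, integral_mul_const, (hker r hr).2, norm_mul, Real.norm_eq_abs,
          abs_of_nonneg (omegaKer_nonneg (by linarith) (by linarith [hr.2]))]
    · refine AEStronglyMeasurable.mul ?_ hfi.1.comp_snd
      refine (Measurable.indicator ?_ hmeas).aestronglyMeasurable
      exact ((measurable_omegaKer a).comp (measurable_const.sub measurable_fst)).mul
        ((measurable_omegaKer b).comp (measurable_fst.sub measurable_snd))
  -- integrating out `r`
  have hin : ∀ s ∈ Ioc 0 t, ∫ r, Φ s r ∂ν = omegaKer a (t - s) * fracInt b f s := by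
    intro s hs
    have e : ∀ r, Φ s r =
        (Iio s).indicator (fun r => omegaKer a (t - s) * (omegaKer b (s - r) * f r)) r := by
      intro r; rw [hval]; simp only [indicator, mem_Iio]; split_ifs <;> ring
    have e2 : Ioc 0 t ∩ Iio s = Ioo 0 s := by
      ext r; simp only [mem_inter_iff, mem_Ioc, mem_Iio, mem_Ioo]
      constructor
      · rintro ⟨⟨h, _⟩, h'⟩; exact ⟨h, h'⟩
      · rintro ⟨h, h'⟩; exact ⟨⟨h, h'.le.trans hs.2⟩, h'⟩
    simp_rw [e]
    rw [hν, setIntegral_indicator measurableSet_Iio, e2, ← integral_Ioc_eq_integral_Ioo,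
      integral_const_mul, fracInt, intervalIntegral.integral_of_le hs.1.le]
  constructor
  · rw [intervalIntegrable_iff_integrableOn_Ioc_of_le ht.le]
    refine (hint.integral_prod_left).congr ?_
    filter_upwards [ae_restrict_mem measurableSet_Ioc] with s hs
    exact hin s hs
  · calc fracInt a (fracInt b f) t = ∫ s, ∫ r, Φ s r ∂ν ∂ν := by
          rw [fracInt, intervalIntegral.integral_of_le ht.le]
          exact (setIntegral_congr_fun measurableSet_Ioc hin).symm
      _ = ∫ r, ∫ s, Φ s r ∂ν ∂ν := integral_integral_swap hint
      _ = fracInt (a + b) f t := by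
          rw [fracInt, intervalIntegral.integral_of_le ht.le]
          refine integral_congr_ae ?_
          filter_upwards [hae] with r hr
          simp_rw [hval]
          rw [integral_mul_const, (hker r hr).2]

theorem omegaKer_one (x : ℝ) : omegaKer 1 x = 1 := by simp [omegaKer]

theorem fracInt_congr_ae {a t : ℝ} {f g : ℝ → ℝ} (ht : 0 ≤ t)
    (h : ∀ᵐ s ∂volume.restrict (Ioc 0 t), f s = g s) : fracInt a f t = fracInt a g t := by
  unfold fracInt
  rw [intervalIntegral.integral_of_le ht, intervalIntegral.integral_of_le ht]
  refine integral_congr_ae ?_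
  filter_upwards [h] with s hs
  rw [hs]

theorem ae_restrict_Ioc_of_Ioo {t T : ℝ} {p : ℝ → Prop} (htT : t < T)
    (h : ∀ᵐ s ∂volume.restrict (Ioo (0 : ℝ) T), p s) : ∀ᵐ s ∂volume.restrict (Ioc 0 t), p s :=
  ae_mono (Measure.restrict_mono (Ioc_subset_Ioo_right htT) le_rfl) h

theorem intervalIntegrable_omegaKer_sub {a t : ℝ} (ha : 0 < a) :
    IntervalIntegrable (fun s => omegaKer a (t - s)) volume 0 t := by
  have := (intervalIntegrable_omegaKer (t := t) ha).comp_sub_left t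
  simpa using this.symm

theorem intervalIntegrable_omegaKer_sub_mul_continuousOn {a t : ℝ} {f : ℝ → ℝ} (ha : 0 < a)
    (ht : 0 ≤ t) (hf : ContinuousOn f (Icc 0 t)) :
    IntervalIntegrable (fun s => omegaKer a (t - s) * f s) volume 0 t :=
  (intervalIntegrable_omegaKer_sub ha).mul_continuousOn (by rwa [uIcc_of_le ht])

theorem LocallyAC.continuousOn {T t : ℝ} {h : ℝ → ℝ} (hh : LocallyAC T h) (ht : t ∈ Ioo 0 T) :
    ContinuousOn h (Icc 0 t) := by
  have := (hh t ht).continuousOn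
  rwa [uIcc_of_le ht.1.le] at this

/-! ### From the Caputo system to a Volterra equation and its Neumann series -/

/-- The Caputo derivative is `I^(1-β) h'`, so the semigroup law leaves `I^1 h'`, and absolute
continuity allows the fundamental theorem of calculus. -/
theorem fracInt_caputo {β T t : ℝ} {h : ℝ → ℝ} (hβ : β ∈ Ioo (0 : ℝ) 1) (hh : LocallyAC T h)
    (ht : t ∈ Ioo 0 T) : fracInt β (caputo β h) t = h t - h 0 := by
  have h1 := (fracInt_fracInt (a := β) (b := 1 - β) (f := deriv h) hβ.1 (by linarith [hβ.2])
    (by linarith) ht.1 (hh t ht).intervalIntegrable_deriv).2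
  have h2 : fracInt (1 - β) (deriv h) = caputo β h := rfl
  rw [h2] at h1
  rw [h1, ← (hh t ht).integral_deriv_eq_sub]
  simp [fracInt, omegaKer_one]

/-- The mode equations in the form of a Volterra equation of the second kind. -/
theorem volterra_of_caputo {β T l b : ℝ} {U V : ℝ → ℝ} (hβ : β ∈ Ioo (1 / 2 : ℝ) 1)
    (hU : LocallyAC T U) (hV : LocallyAC T V) (hV0 : V 0 = 0)
    (h1 : ∀ᵐ t ∂volume.restrict (Ioo (0 : ℝ) T), V t = caputo β U t)
    (h2 : ∀ᵐ t ∂volume.restrict (Ioo (0 : ℝ) T),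
      caputo β V t = -l * U t + b * omegaKer (2 - 2 * β) t) {t : ℝ} (ht : t ∈ Ioo 0 T) :
    V t = -l * U 0 * omegaKer (β + 1) t + b * omegaKer (2 - β) t
      - l * fracInt (2 * β) V t := by
  have hβ0 : 0 < β := by linarith [hβ.1]
  have hβ' : β ∈ Ioo (0 : ℝ) 1 := ⟨hβ0, hβ.2⟩
  have hUeq : ∀ s ∈ Ioo 0 T, U s = U 0 + fracInt β V s := by
    intro s hs
    rw [fracInt_congr_ae hs.1.le (ae_restrict_Ioc_of_Ioo hs.2 h1), fracInt_caputo hβ' hU hs]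
    ring
  have hVc := hV.continuousOn ht
  have hVi : IntervalIntegrable V volume 0 t :=
    ContinuousOn.intervalIntegrable (by rwa [uIcc_of_le ht.1.le])
  -- The assumption `β > 1/2` enters here: the composed order `2β` must be at least `1`.
  have hIV := fracInt_fracInt hβ0 hβ0 (by linarith [hβ.1]) ht.1 hVi
  have hIU : fracInt β U t = U 0 * omegaKer (β + 1) t + fracInt (2 * β) V t := by
    have e : fracInt β U t = fracInt β (fun s => U 0 + fracInt β V s) t := by
      refine fracInt_congr_ae ht.1.le ?_
      filter_upwards [ae_restrict_mem measurableSet_Ioc] with s hs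
      exact hUeq s ⟨hs.1, hs.2.trans_lt ht.2⟩
    have e1 : fracInt β (omegaKer 1) t = omegaKer (β + 1) t :=
      fracInt_omegaKer hβ0 one_pos ht.1
    have hi := intervalIntegrable_omegaKer_sub (t := t) hβ0
    rw [e, ← e1, two_mul, ← hIV.2]
    simp only [fracInt, omegaKer_one, mul_one, mul_add] at hIV ⊢
    rw [intervalIntegral.integral_add (hi.mul_const _) hIV.1, intervalIntegral.integral_mul_const,
      mul_comm]
  have e : fracInt β (caputo β V) t = V t := by rw [fracInt_caputo hβ' hV ht, hV0, sub_zero]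
  have hb := fracInt_omegaKer (a := β) (b := 2 - 2 * β) hβ0 (by linarith [hβ.2]) ht.1
  have hbi : IntervalIntegrable (fun s => omegaKer β (t - s) * omegaKer (2 - 2 * β) s) volume 0 t := by
    simpa using intervalIntegrable_omegaKer_mul_omegaKer (a := β) (b := 2 - 2 * β) hβ0
      (by linarith [hβ.2]) ht.1
  -- The equation for `V` holds only almost everywhere, but it is used under the integral `I^β`;
  -- hence the conclusion holds at every `t`.
  rw [← e, fracInt_congr_ae ht.1.le (ae_restrict_Ioc_of_Ioo ht.2 h2)]
  have hi := intervalIntegrable_omegaKer_sub_mul_continuousOn hβ0 ht.1.le (hU.continuousOn ht)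
  have : fracInt β (fun s => -l * U s + b * omegaKer (2 - 2 * β) s) t =
      -l * fracInt β U t + b * fracInt β (omegaKer (2 - 2 * β)) t := by
    simp only [fracInt]
    rw [← intervalIntegral.integral_const_mul, ← intervalIntegral.integral_const_mul,
      ← intervalIntegral.integral_add (hi.const_mul _) (hbi.const_mul _)]
    congr 1 with s
    ring
  rw [this, hIU, hb, show β + (2 - 2 * β) = 2 - β by ring]
  ring

/-- Neumann series of a Volterra equation with kernel `-l ω_a`. -/
theorem volterra_iterate {a l A B μ₁ μ₂ T : ℝ} {V : ℝ → ℝ} (ha : 1 ≤ a) (h₁ : 0 < μ₁)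
    (h₂ : 0 < μ₂) (hV : ∀ t ∈ Ioo 0 T, ContinuousOn V (Icc 0 t))
    (hVol : ∀ t ∈ Ioo 0 T, V t = A * omegaKer μ₁ t + B * omegaKer μ₂ t - l * fracInt a V t)
    {t : ℝ} (ht : t ∈ Ioo 0 T) (N : ℕ) :
    V t = ∑ k ∈ Finset.range (N + 1),
        (-l) ^ k * (A * omegaKer (a * k + μ₁) t + B * omegaKer (a * k + μ₂) t)
      + (-l) ^ (N + 1) * fracInt (a * (N + 1)) V t := by
  have ha0 : 0 < a := by linarith
  induction N with
  | zero => simp [← sub_eq_add_neg, hVol t ht]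
  | succ N ih =>
    set c : ℝ := a * (N + 1) with hc
    have hN : (0 : ℝ) ≤ N := N.cast_nonneg
    have hc1 : 1 ≤ c := by nlinarith
    have hc0 : 0 < c := by linarith
    have hVi : IntervalIntegrable V volume 0 t :=
      ContinuousOn.intervalIntegrable (by rw [uIcc_of_le ht.1.le]; exact hV t ht)
    have hIV := fracInt_fracInt hc0 ha0 (by linarith) ht.1 hVi
    -- The Volterra equation is inserted into the remainder, and `I^c I^a = I^(c+a)` turns it into
    -- the next term plus the next remainder.
    have e : fracInt c V t =
        A * omegaKer (c + μ₁) t + B * omegaKer (c + μ₂) t - l * fracInt (c + a) V t := by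
      have e0 : fracInt c V t =
          fracInt c (fun s => A * omegaKer μ₁ s + B * omegaKer μ₂ s - l * fracInt a V s) t := by
        refine fracInt_congr_ae ht.1.le ?_
        filter_upwards [ae_restrict_mem measurableSet_Ioc] with s hs
        exact hVol s ⟨hs.1, hs.2.trans_lt ht.2⟩
      have i₁ := intervalIntegrable_omegaKer_sub_mul hc1 ht.1.le
        (intervalIntegrable_omegaKer (t := t) h₁)
      have i₂ := intervalIntegrable_omegaKer_sub_mul hc1 ht.1.le
        (intervalIntegrable_omegaKer (t := t) h₂)
      rw [e0, ← hIV.2, ← fracInt_omegaKer hc0 h₁ ht.1, ← fracInt_omegaKer hc0 h₂ ht.1]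
      simp only [fracInt] at hIV ⊢
      rw [← intervalIntegral.integral_const_mul, ← intervalIntegral.integral_const_mul,
        ← intervalIntegral.integral_const_mul,
        ← intervalIntegral.integral_add (i₁.const_mul _) (i₂.const_mul _),
        ← intervalIntegral.integral_sub ((i₁.const_mul _).add (i₂.const_mul _))
          (hIV.1.const_mul _)]
      congr 1 with s
      ring
    rw [Finset.sum_range_succ, ih, e]
    push_cast
    rw [← hc, show a * ((N : ℝ) + 1 + 1) = c + a by rw [hc]; ring]
    ring

theorem tendsto_volterra_remainder {a l t : ℝ} {V : ℝ → ℝ} (ha : 1 ≤ a) (ht : 0 < t)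
    (hV : ContinuousOn V (Icc 0 t)) :
    Filter.Tendsto (fun N : ℕ => (-l) ^ (N + 1) * fracInt (a * (N + 1)) V t) Filter.atTop
      (nhds 0) := by
  obtain ⟨K, hK⟩ := isCompact_Icc.exists_bound_of_continuousOn hV
  have hK0 : 0 ≤ K := (norm_nonneg _).trans (hK 0 ⟨le_rfl, ht.le⟩)
  -- The index is raised by one so that Gamma is compared at arguments `≥ 2`, where it is
  -- increasing; this gives `Γ(c) ≥ (N + 1)!`.
  have hbound : ∀ N : ℕ, ‖(-l) ^ (N + 2) * fracInt (a * ((N + 1 : ℕ) + 1)) V t‖ ≤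
      K * ((|l| * t ^ a) ^ (N + 2) / (N + 2 - 1).factorial) := by
    intro N
    have hN : (0 : ℝ) ≤ N := N.cast_nonneg
    set c : ℝ := a * ((N + 1 : ℕ) + 1) with hc
    have hcN : (N : ℝ) + 2 ≤ c := by rw [hc]; push_cast; nlinarith
    have hG : ((N + 2 - 1).factorial : ℝ) ≤ Real.Gamma c := by
      have h1 : Real.Gamma ((N + 1 : ℕ) + 1) = ((N + 1).factorial : ℝ) :=
        Real.Gamma_nat_eq_factorial _
      have h2 : Real.Gamma ((N + 1 : ℕ) + 1) ≤ Real.Gamma c :=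
        Real.Gamma_strictMonoOn_Ici.monotoneOn (by simp only [mem_Ici]; push_cast; linarith)
          (by simp only [mem_Ici]; linarith) (by push_cast; linarith)
      rw [h1] at h2
      exact h2
    have hfac : (0 : ℝ) < (N + 2 - 1).factorial := by positivity
    have hom : ∀ x ∈ uIoc 0 t, ‖omegaKer c (t - x) * V x‖ ≤
        t ^ (c - 1) / (N + 2 - 1).factorial * K := by
      intro x hx
      rw [uIoc_of_le ht.le] at hx
      rw [norm_mul, Real.norm_eq_abs, abs_of_nonneg (omegaKer_nonneg (by linarith)
        (by linarith [hx.2]))]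
      have h3 := omegaKer_le_of_le (a := c) (x := t - x) (t := t) (by linarith)
        (by linarith [hx.2]) (by linarith [hx.1])
      have h4 : omegaKer c t ≤ t ^ (c - 1) / (N + 2 - 1).factorial := by
        unfold omegaKer; gcongr
      exact mul_le_mul (h3.trans h4) (hK x ⟨hx.1.le, hx.2⟩) (norm_nonneg _) (by positivity)
    have h5 := intervalIntegral.norm_integral_le_of_norm_le_const hom
    rw [sub_zero, abs_of_pos ht] at h5
    rw [norm_mul, norm_pow, norm_neg, Real.norm_eq_abs l]
    have h6 : t ^ (c - 1) * t = (t ^ a) ^ (N + 2) := by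
      rw [← Real.rpow_add_one ht.ne', ← Real.rpow_natCast, ← Real.rpow_mul ht.le, hc]
      congr 1; push_cast; ring
    calc |l| ^ (N + 2) * ‖fracInt c V t‖
        ≤ |l| ^ (N + 2) * (t ^ (c - 1) / (N + 2 - 1).factorial * K * t) := by gcongr; exact h5
      _ = K * (|l| ^ (N + 2) * (t ^ (c - 1) * t) / (N + 2 - 1).factorial) := by ring
      _ = _ := by rw [h6, mul_pow]
  rw [← Filter.tendsto_add_atTop_iff_nat 1]
  refine squeeze_zero_norm hbound ?_
  have h7 := (FloorSemiring.tendsto_pow_div_factorial_atTop (|l| * t ^ a)).comp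
    (Filter.tendsto_add_atTop_nat 1)
  have h8 := (h7.const_mul (K * (|l| * t ^ a)))
  rw [mul_zero] at h8
  refine h8.congr fun N => ?_
  simp only [Function.comp, show N + 2 - 1 = N + 1 from rfl]
  ring

/-! ### Rays in the complex plane and displacement of their vertex -/

/-- The point at distance `r` from the vertex `x` on the ray of direction `exp (i θ)`. -/
def ray (θ x r : ℝ) : ℂ := x + r * Complex.exp (θ * Complex.I)

/-- The integral of `F` along the ray of direction `exp (i θ)` that starts at `x`. -/
def rayInt (θ x : ℝ) (F : ℂ → ℂ) : ℂ :=
  ∫ r in Ioi (0 : ℝ), Complex.exp (θ * Complex.I) * F (ray θ x r)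

theorem ray_re (θ x r : ℝ) : (ray θ x r).re = x + r * Real.cos θ := by
  simp [ray, Complex.exp_ofReal_mul_I_re, Complex.exp_ofReal_mul_I_im]

theorem ray_im (θ x r : ℝ) : (ray θ x r).im = r * Real.sin θ := by
  simp [ray, Complex.exp_ofReal_mul_I_re, Complex.exp_ofReal_mul_I_im]

theorem ray_zero_right (θ x : ℝ) : ray θ x 0 = x := by simp [ray]

theorem norm_exp_mul_I (θ : ℝ) : ‖Complex.exp (θ * Complex.I)‖ = 1 :=
  Complex.norm_exp_ofReal_mul_I θ

theorem norm_ray_zero {θ r : ℝ} (hr : 0 ≤ r) : ‖ray θ 0 r‖ = r := by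
  simp [ray, abs_of_nonneg hr]

theorem continuous_ray (θ : ℝ) : Continuous fun p : ℝ × ℝ => ray θ p.1 p.2 := by
  unfold ray; fun_prop

section sector

variable {θ x r : ℝ}

theorem ray_mem_slitPlane (hθ : 0 < Real.sin θ) (hr : 0 ≤ r) (h : 0 < x + r) :
    ray θ x r ∈ Complex.slitPlane := by
  rw [Complex.mem_slitPlane_iff, ray_re, ray_im]
  rcases eq_or_lt_of_le hr with rfl | hr
  · left; simpa using h
  · right; positivity

theorem ray_ne_zero (hθ : 0 < Real.sin θ) (hr : 0 ≤ r) (h : 0 < x + r) :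
    ray θ x r ≠ 0 :=
  Complex.slitPlane_ne_zero (ray_mem_slitPlane hθ hr h)

theorem sin_mul_le_norm_ray (hθ : 0 < Real.sin θ) (hr : 0 ≤ r) :
    r * Real.sin θ ≤ ‖ray θ x r‖ := by
  have := Complex.abs_im_le_norm (ray θ x r)
  rw [ray_im, abs_of_nonneg (by positivity)] at this
  exact this

theorem ray_mul_exp_neg_im (θ x r : ℝ) :
    (ray θ x r * Complex.exp (((-θ : ℝ) : ℂ) * Complex.I)).im = -(x * Real.sin θ) := by
  rw [Complex.mul_im, Complex.exp_ofReal_mul_I_re, Complex.exp_ofReal_mul_I_im, ray_re, ray_im,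
    Real.cos_neg, Real.sin_neg]
  ring

/-- The line that carries the ray has distance `x sin θ` from the origin, as rotation by `-θ` makes
visible. -/
theorem sin_mul_le_norm_ray' (hθ : 0 < Real.sin θ) (hx : 0 ≤ x) :
    x * Real.sin θ ≤ ‖ray θ x r‖ := by
  have := Complex.abs_im_le_norm (ray θ x r * Complex.exp (((-θ : ℝ) : ℂ) * Complex.I))
  rwa [ray_mul_exp_neg_im, norm_mul, norm_exp_mul_I, mul_one, abs_neg,
    abs_of_nonneg (by positivity)] at this

theorem arg_ray_nonneg (hθ : 0 < Real.sin θ) (hr : 0 ≤ r) : 0 ≤ (ray θ x r).arg := by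
  rw [Complex.arg_nonneg_iff, ray_im]; positivity

/-- Rotation by `-θ` gives the ray the constant imaginary part `-x sin θ ≤ 0`, whereas an argument
above `θ` would make it positive. -/
theorem arg_ray_le (hθ0 : 0 < θ) (hθπ : θ < Real.pi) (hx : 0 ≤ x) (hr : 0 ≤ r) (h : 0 < x + r) :
    (ray θ x r).arg ≤ θ := by
  have hθ : 0 < Real.sin θ := Real.sin_pos_of_pos_of_lt_pi hθ0 hθπ
  by_contra! hlt
  set s := ray θ x r with hs
  have hs0 : 0 < ‖s‖ := norm_pos_iff.2 (ray_ne_zero hθ hr h)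
  have h1 := ray_mul_exp_neg_im θ x r
  rw [← hs, ← Complex.norm_mul_exp_arg_mul_I s, mul_assoc, ← Complex.exp_add, ← add_mul,
    ← Complex.ofReal_add, Complex.im_ofReal_mul, Complex.exp_ofReal_mul_I_im] at h1
  have h2 : 0 < Real.sin (s.arg + -θ) :=
    Real.sin_pos_of_pos_of_lt_pi (by linarith) (by linarith [Complex.arg_le_pi s])
  have h3 : 0 < ‖s‖ * Real.sin (s.arg + -θ) := by positivity
  have h4 : 0 ≤ x * Real.sin θ := by positivity
  linarith

end sector

theorem hasFDerivAt_comp_ray {θ : ℝ} {F : ℂ → ℂ} {p : ℝ × ℝ}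
    (hF : DifferentiableAt ℂ F (ray θ p.1 p.2)) :
    HasFDerivAt (fun q : ℝ × ℝ => F (ray θ q.1 q.2))
      ((ContinuousLinearMap.fst ℝ ℝ ℝ).smulRight (deriv F (ray θ p.1 p.2)) +
        (ContinuousLinearMap.snd ℝ ℝ ℝ).smulRight
          (Complex.exp (θ * Complex.I) * deriv F (ray θ p.1 p.2))) p := by
  have h1 : HasFDerivAt (fun q : ℝ × ℝ => ray θ q.1 q.2)
      ((ContinuousLinearMap.fst ℝ ℝ ℝ).smulRight (1 : ℂ) +
        (ContinuousLinearMap.snd ℝ ℝ ℝ).smulRight (Complex.exp (θ * Complex.I))) p := by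
    have e : (fun q : ℝ × ℝ => ray θ q.1 q.2) = fun q => ((ContinuousLinearMap.fst ℝ ℝ ℝ).smulRight (1 : ℂ) +
        (ContinuousLinearMap.snd ℝ ℝ ℝ).smulRight (Complex.exp (θ * Complex.I))) q := by
      ext q; simp [ray]
    rw [e]
    exact ContinuousLinearMap.hasFDerivAt _
  have h2 := (hF.hasDerivAt.hasFDerivAt.restrictScalars ℝ).comp p h1
  refine h2.congr_fderiv ?_
  ext
  · simp
  · simp

/-- Cauchy's theorem on the parallelogram between the two rays, cut off at distance `M`. The far
side vanishes as `M → ∞`, and the side on the real axis contributes a real number, so the imaginary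
parts agree. -/
theorem rayInt_im_eq_of_pos {θ x₁ x₂ : ℝ} {F : ℂ → ℂ} {G : ℝ → ℝ} (h₁ : 0 < x₁) (h₁₂ : x₁ ≤ x₂)
    (hd : ∀ x r, 0 < x → 0 ≤ r → DifferentiableAt ℂ F (ray θ x r))
    (hreal : ∀ x : ℝ, 0 < x → (F x).im = 0)
    (hG : ∀ x ∈ Icc x₁ x₂, ∀ r, 0 < r → ‖F (ray θ x r)‖ ≤ G r)
    (hGi : IntegrableOn G (Ioi 0)) (hG0 : Filter.Tendsto G Filter.atTop (nhds 0)) :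
    (rayInt θ x₂ F).im = (rayInt θ x₁ F).im := by
  set e : ℂ := Complex.exp (θ * Complex.I) with he
  have hen : ‖e‖ = 1 := norm_exp_mul_I θ
  have hcont : ∀ x, 0 < x → ContinuousOn (fun r => e * F (ray θ x r)) (Ici 0) := by
    intro x hx r hr
    refine (continuousAt_const.mul ?_).continuousWithinAt
    exact ContinuousAt.comp (f := fun r => ray θ x r) (hd x r hx hr).continuousAt
      ((continuous_ray θ).comp (Continuous.prodMk_right x)).continuousAt
  have hint : ∀ x ∈ Icc x₁ x₂, IntegrableOn (fun r => e * F (ray θ x r)) (Ioi 0) := by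
    intro x hx
    refine Integrable.mono' hGi (((hcont x (h₁.trans_le hx.1)).mono Ioi_subset_Ici_self).aestronglyMeasurable
      measurableSet_Ioi) ?_
    filter_upwards [ae_restrict_mem measurableSet_Ioi] with r hr
    rw [norm_mul, hen, one_mul]
    exact hG x hx r hr
  have hlim : ∀ x ∈ Icc x₁ x₂, Filter.Tendsto (fun M => ∫ r in (0 : ℝ)..M, e * F (ray θ x r))
      Filter.atTop (nhds (rayInt θ x F)) := fun x hx =>
    intervalIntegral_tendsto_integral_Ioi 0 (hint x hx) Filter.tendsto_id
  have hhor : Filter.Tendsto (fun M => ∫ x in x₁..x₂, F (ray θ x M)) Filter.atTop (nhds 0) := by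
    have h0 : Filter.Tendsto (fun M => G M * |x₂ - x₁|) Filter.atTop (nhds 0) := by
      simpa using hG0.mul_const |x₂ - x₁|
    refine squeeze_zero_norm' ?_ h0
    filter_upwards [Filter.eventually_gt_atTop 0] with M hM
    refine intervalIntegral.norm_integral_le_of_norm_le_const fun x hx => ?_
    rw [uIoc_of_le h₁₂] at hx
    exact hG x ⟨hx.1.le, hx.2⟩ M hM
  have hbox : ∀ M, 0 < M → (∫ r in (0 : ℝ)..M, e * F (ray θ x₂ r)) -
      (∫ r in (0 : ℝ)..M, e * F (ray θ x₁ r)) =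
      (∫ x in x₁..x₂, F (ray θ x M)) - ∫ x in x₁..x₂, F x := by
    intro M hM
    have hd' : ∀ p : ℝ × ℝ, p ∈ Icc x₁ x₂ ×ˢ Icc 0 M → DifferentiableAt ℂ F (ray θ p.1 p.2) :=
      fun p hp => hd _ _ (h₁.trans_le hp.1.1) hp.2.1
    have hc : ContinuousOn (fun p : ℝ × ℝ => F (ray θ p.1 p.2)) (Icc x₁ x₂ ×ˢ Icc 0 M) :=
      fun p hp => (hasFDerivAt_comp_ray (hd' p hp)).continuousAt.continuousWithinAt
    -- In the coordinates `(x, r)` the field `(e F, -F)` has divergence `e F' - e F' = 0`, so the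
    -- divergence theorem yields Cauchy's theorem.
    have key := integral2_divergence_prod_of_hasFDerivAt_off_countable
      (fun p : ℝ × ℝ => e * F (ray θ p.1 p.2)) (fun p : ℝ × ℝ => -F (ray θ p.1 p.2))
      (fun p => e • ((ContinuousLinearMap.fst ℝ ℝ ℝ).smulRight (deriv F (ray θ p.1 p.2)) +
        (ContinuousLinearMap.snd ℝ ℝ ℝ).smulRight (e * deriv F (ray θ p.1 p.2))))
      (fun p => -((ContinuousLinearMap.fst ℝ ℝ ℝ).smulRight (deriv F (ray θ p.1 p.2)) +
        (ContinuousLinearMap.snd ℝ ℝ ℝ).smulRight (e * deriv F (ray θ p.1 p.2))))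
      x₁ 0 x₂ M ∅ countable_empty
      (by rw [uIcc_of_le h₁₂, uIcc_of_le hM.le]; exact continuousOn_const.mul hc)
      (by rw [uIcc_of_le h₁₂, uIcc_of_le hM.le]; exact hc.neg)
      (by
        rw [min_eq_left h₁₂, max_eq_right h₁₂, min_eq_left hM.le, max_eq_right hM.le]
        intro p hp
        exact (hasFDerivAt_comp_ray (hd' p ⟨Ioo_subset_Icc_self hp.1.1,
          Ioo_subset_Icc_self hp.1.2⟩)).const_smul e)
      (by
        rw [min_eq_left h₁₂, max_eq_right h₁₂, min_eq_left hM.le, max_eq_right hM.le]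
        intro p hp
        exact (hasFDerivAt_comp_ray (hd' p ⟨Ioo_subset_Icc_self hp.1.1,
          Ioo_subset_Icc_self hp.1.2⟩)).neg)
      (by simp)
    simp only [smul_apply, add_apply,
      ContinuousLinearMap.smulRight_apply, ContinuousLinearMap.coe_fst',
      ContinuousLinearMap.coe_snd', neg_apply, one_smul, zero_smul, add_zero,
      zero_add, smul_eq_mul, add_neg_cancel, intervalIntegral.integral_zero,
      intervalIntegral.integral_neg, ray_zero_right] at key
    linear_combination -key
  have hfin : rayInt θ x₂ F - rayInt θ x₁ F = 0 - ∫ x in x₁..x₂, F x := by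
    refine tendsto_nhds_unique ((hlim x₂ ⟨h₁₂, le_rfl⟩).sub (hlim x₁ ⟨le_rfl, h₁₂⟩))
      ((hhor.sub_const _).congr' ?_)
    filter_upwards [Filter.eventually_gt_atTop 0] with M hM
    exact (hbox M hM).symm
  have hre : ∫ x in x₁..x₂, F x = ((∫ x in x₁..x₂, (F x).re : ℝ) : ℂ) := by
    rw [← intervalIntegral.integral_ofReal]
    refine intervalIntegral.integral_congr fun x hx => ?_
    rw [uIcc_of_le h₁₂] at hx
    exact Complex.ext (by simp) (by simp [hreal x (h₁.trans_le hx.1)])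
  have := congrArg Complex.im hfin
  rw [hre] at this
  simp at this
  linarith

/-- The imaginary part of the integral of a function that is real on the positive half-line does
not depend on the vertex of the ray. -/
theorem rayInt_im_eq_zero {θ X : ℝ} {F : ℂ → ℂ} {G : ℝ → ℝ} (hX : 0 < X)
    (hd : ∀ x r, 0 ≤ x → 0 ≤ r → 0 < x + r → DifferentiableAt ℂ F (ray θ x r))
    (hreal : ∀ x : ℝ, 0 < x → (F x).im = 0)
    (hG : ∀ x ∈ Icc 0 X, ∀ r, 0 < r → ‖F (ray θ x r)‖ ≤ G r)
    (hGi : IntegrableOn G (Ioi 0)) (hG0 : Filter.Tendsto G Filter.atTop (nhds 0)) :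
    (rayInt θ X F).im = (rayInt θ 0 F).im := by
  have hen : ‖Complex.exp (θ * Complex.I)‖ = 1 := norm_exp_mul_I θ
  have hcont : ∀ x r, 0 ≤ x → 0 < r →
      ContinuousAt (fun p : ℝ × ℝ => Complex.exp (θ * Complex.I) * F (ray θ p.1 p.2)) (x, r) := by
    intro x r hx hr
    exact continuousAt_const.mul (hasFDerivAt_comp_ray (p := (x, r))
      (hd x r hx hr.le (by linarith))).continuousAt
  -- `F` may be singular at the origin, so the vertex `0` is reached as a limit from the right, with
  -- `G` as dominating function.
  have hlim : Filter.Tendsto (fun x => rayInt θ x F) (nhdsWithin 0 (Ioi 0))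
      (nhds (rayInt θ 0 F)) := by
    have hmem : ∀ᶠ x in nhdsWithin (0 : ℝ) (Ioi 0), x ∈ Ioo 0 X :=
      Ioo_mem_nhdsGT hX
    refine tendsto_integral_filter_of_dominated_convergence G ?_ ?_ hGi ?_
    · filter_upwards [hmem] with x hx
      refine ContinuousOn.aestronglyMeasurable (fun r hr => ?_) measurableSet_Ioi
      exact (ContinuousAt.comp (f := fun r => (x, r)) (hcont x r hx.1.le hr)
        (Continuous.prodMk_right x).continuousAt).continuousWithinAt
    · filter_upwards [hmem] with x hx
      filter_upwards [ae_restrict_mem measurableSet_Ioi] with r hr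
      rw [norm_mul, hen, one_mul]
      exact hG x ⟨hx.1.le, hx.2.le⟩ r hr
    · filter_upwards [ae_restrict_mem measurableSet_Ioi] with r hr
      exact (ContinuousAt.comp (f := fun x => (x, r)) (hcont 0 r le_rfl hr)
        (Continuous.prodMk_left r).continuousAt).tendsto.mono_left nhdsWithin_le_nhds
  have hlim' := (Complex.continuous_im.tendsto _).comp hlim
  refine tendsto_nhds_unique (tendsto_const_nhds.congr' ?_) hlim'
  filter_upwards [Ioo_mem_nhdsGT hX] with x hx
  exact rayInt_im_eq_of_pos hx.1 hx.2.le (fun y r hy hr => hd y r hy.le hr (by linarith)) hreal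
    (fun y hy => hG y ⟨hx.1.le.trans hy.1, hy.2⟩) hGi hG0

/-! ### The integrals of Euler and Hankel -/

theorem integrableOn_rpow_mul_exp {p c : ℝ} (hp : -1 < p) (hc : 0 < c) :
    IntegrableOn (fun r : ℝ => r ^ p * Real.exp (-c * r)) (Ioi 0) := by
  simpa using integrableOn_rpow_mul_exp_neg_mul_rpow (p := 1) hp one_pos hc

theorem differentiableAt_integral_rpow_mul_cexp {a : ℝ} (ha : 0 < a) {z : ℂ} (hz : 0 < z.re) :
    DifferentiableAt ℂ (fun w : ℂ => ∫ r in Ioi (0 : ℝ),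
      ((r ^ (a - 1) : ℝ) : ℂ) * Complex.exp (-w * r)) z := by
  have hmeas : ∀ w : ℂ, ∀ p : ℝ, AEStronglyMeasurable
      (fun r : ℝ => ((r ^ p : ℝ) : ℂ) * Complex.exp (-w * r)) (volume.restrict (Ioi 0)) := by
    intro w p
    refine ContinuousOn.aestronglyMeasurable (fun r hr => ?_) measurableSet_Ioi
    have h1 : ContinuousAt (fun r : ℝ => ((r ^ p : ℝ) : ℂ)) r :=
      Complex.continuous_ofReal.continuousAt.comp
        (Real.continuousAt_rpow_const _ _ (Or.inl (ne_of_gt hr)))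
    exact (h1.mul (by fun_prop)).continuousWithinAt
  have hnorm : ∀ w : ℂ, ∀ p r : ℝ, 0 < r → ‖((r ^ p : ℝ) : ℂ) * Complex.exp (-w * r)‖ =
      r ^ p * Real.exp (-w.re * r) := by
    intro w p r hr
    rw [norm_mul, Complex.norm_exp, Complex.norm_real, Real.norm_eq_abs,
      abs_of_nonneg (Real.rpow_nonneg hr.le _)]
    simp
  have hs : {w : ℂ | z.re / 2 < w.re} ∈ nhds z :=
    (isOpen_lt continuous_const Complex.continuous_re).mem_nhds (by simp; linarith)
  refine (hasDerivAt_integral_of_dominated_loc_of_deriv_le (𝕜 := ℂ)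
    (μ := volume.restrict (Ioi (0 : ℝ)))
    (F := fun w r => ((r ^ (a - 1) : ℝ) : ℂ) * Complex.exp (-w * r))
    (F' := fun w r => -(((r ^ a : ℝ) : ℂ) * Complex.exp (-w * r)))
    (bound := fun r => r ^ a * Real.exp (-(z.re / 2) * r)) hs
    (Filter.Eventually.of_forall fun w => hmeas w _) ?_ (hmeas z _).neg ?_
    (integrableOn_rpow_mul_exp (by linarith) (by linarith)) ?_).2.differentiableAt
  · refine Integrable.mono' (integrableOn_rpow_mul_exp (p := a - 1) (by linarith) hz) (hmeas z _) ?_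
    filter_upwards [ae_restrict_mem measurableSet_Ioi] with r hr
    rw [hnorm _ _ _ hr]
  · filter_upwards [ae_restrict_mem measurableSet_Ioi] with r hr w hw
    have hr' : (0 : ℝ) < r := hr
    rw [norm_neg, hnorm _ _ _ hr]
    have : z.re / 2 < w.re := hw
    gcongr
  · filter_upwards [ae_restrict_mem measurableSet_Ioi] with r hr w _
    have h1 : HasDerivAt (fun w : ℂ => Complex.exp (-w * r)) (Complex.exp (-w * r) * (-1 * r)) w :=
      ((hasDerivAt_id w).neg.mul_const _).cexp
    refine (h1.const_mul _).congr_deriv ?_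
    have h2 : r ^ a = r ^ (a - 1) * r := by
      rw [← Real.rpow_add_one (ne_of_gt hr)]; congr 1; ring
    rw [h2]
    push_cast
    ring

/-- Euler's integral with a complex rate. -/
theorem integral_rpow_mul_cexp {a : ℝ} (ha : 0 < a) {z : ℂ} (hz : 0 < z.re) :
    ∫ r in Ioi (0 : ℝ), ((r ^ (a - 1) : ℝ) : ℂ) * Complex.exp (-z * r) =
      Real.Gamma a * z ^ (-(a : ℂ)) := by
  have hopen : IsOpen {w : ℂ | 0 < w.re} := isOpen_lt continuous_const Complex.continuous_re
  have hconv : Convex ℝ {w : ℂ | 0 < w.re} := convex_halfSpace_re_gt 0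
  have h1 : AnalyticOnNhd ℂ (fun w : ℂ => ∫ r in Ioi (0 : ℝ),
      ((r ^ (a - 1) : ℝ) : ℂ) * Complex.exp (-w * r)) {w : ℂ | 0 < w.re} :=
    DifferentiableOn.analyticOnNhd (fun w hw =>
      (differentiableAt_integral_rpow_mul_cexp ha hw).differentiableWithinAt) hopen
  have h2 : AnalyticOnNhd ℂ (fun w : ℂ => (Real.Gamma a : ℂ) * w ^ (-(a : ℂ))) {w : ℂ | 0 < w.re} :=
    DifferentiableOn.analyticOnNhd (fun w hw =>
      (((hasDerivAt_id w).cpow_const (c := -(a : ℂ)) (Or.inl hw)).const_mul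
        (Real.Gamma a : ℂ)).differentiableAt.differentiableWithinAt) hopen
  have hreal : ∀ x : ℝ, 0 < x → ∫ r in Ioi (0 : ℝ),
      ((r ^ (a - 1) : ℝ) : ℂ) * Complex.exp (-(x : ℂ) * r) = Real.Gamma a * (x : ℂ) ^ (-(a : ℂ)) := by
    intro x hx
    have := Real.integral_rpow_mul_exp_neg_mul_Ioi ha hx
    have e : ∀ r : ℝ, ((r ^ (a - 1) : ℝ) : ℂ) * Complex.exp (-(x : ℂ) * r) =
        ((r ^ (a - 1) * Real.exp (-(x * r)) : ℝ) : ℂ) := by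
      intro r; push_cast; rw [neg_mul]
    simp_rw [e]
    rw [integral_complex_ofReal, this, one_div, Real.inv_rpow hx.le, ← Real.rpow_neg hx.le, mul_comm]
    push_cast
    rw [Complex.ofReal_cpow hx.le]
    push_cast
    rfl
  -- Identity theorem on the right half-plane: both sides are analytic and agree on real points that
  -- accumulate at `1`.
  refine h1.eqOn_of_preconnected_of_frequently_eq h2 hconv.isPreconnected (z₀ := 1) (by simp) ?_ hz
  have ht : Filter.Tendsto (fun x : ℝ => (x : ℂ)) (nhdsWithin 1 (Ioi 1)) (nhdsWithin 1 {1}ᶜ) := by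
    refine tendsto_nhdsWithin_iff.2 ⟨?_, ?_⟩
    · have := (Complex.continuous_ofReal.tendsto 1).mono_left (nhdsWithin_le_nhds (s := Ioi 1))
      simpa using this
    · filter_upwards [self_mem_nhdsWithin] with x hx
      simp only [mem_compl_iff, mem_singleton_iff]
      exact_mod_cast (ne_of_gt hx : x ≠ 1)
  refine ht.frequently (Filter.Eventually.frequently ?_)
  filter_upwards [self_mem_nhdsWithin] with x hx
  exact hreal x (one_pos.trans hx)

theorem norm_cexp_ray (θ t x r : ℝ) :
    ‖Complex.exp (t * ray θ x r)‖ = Real.exp (t * x) * Real.exp (-(-(t * Real.cos θ)) * r) := by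
  rw [Complex.norm_exp, Complex.re_ofReal_mul, ray_re, ← Real.exp_add]
  congr 1; ring

/-- The exponential decays along the ray because `cos θ < 0`, and `a < 1` makes `r ^ (-a)`
integrable at the vertex. Together they supply a majorant uniform in the vertex `x ≤ X`. -/
theorem rayInt_im_cexp_mul_eq_zero {θ t X K a : ℝ} {W : ℂ → ℂ} (hθ : Real.cos θ < 0) (ht : 0 < t)
    (hX : 0 < X) (ha : a < 1)
    (hd : ∀ x r, 0 ≤ x → 0 ≤ r → 0 < x + r → DifferentiableAt ℂ W (ray θ x r))
    (hreal : ∀ x : ℝ, 0 < x → (W x).im = 0)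
    (hW : ∀ x, 0 ≤ x → ∀ r, 0 < r → ‖W (ray θ x r)‖ ≤ K * r ^ (-a)) :
    (rayInt θ X fun s => Complex.exp (t * s) * W s).im =
      (rayInt θ 0 fun s => Complex.exp (t * s) * W s).im := by
  have hc : 0 < -(t * Real.cos θ) := by nlinarith
  refine rayInt_im_eq_zero (G := fun r => Real.exp (t * X) * K *
    (r ^ (-a) * Real.exp (-(-(t * Real.cos θ)) * r))) hX ?_ ?_ ?_ ?_ ?_
  · intro x r hx hr h
    exact (by fun_prop : DifferentiableAt ℂ (fun s : ℂ => Complex.exp (t * s)) _).mul (hd x r hx hr h)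
  · intro x hx
    have : Complex.exp (t * x) = ((Real.exp (t * x) : ℝ) : ℂ) := by push_cast; rfl
    rw [this, Complex.im_ofReal_mul, hreal x hx, mul_zero]
  · intro x hx r hr
    rw [norm_mul, norm_cexp_ray]
    have h1 := hW x hx.1 r hr
    have h2 : Real.exp (t * x) ≤ Real.exp (t * X) := by gcongr; exact hx.2
    calc _ ≤ Real.exp (t * X) * Real.exp (-(-(t * Real.cos θ)) * r) * (K * r ^ (-a)) := by gcongr
      _ = _ := by ring
  · exact (integrableOn_rpow_mul_exp (by linarith) hc).const_mul _
  · simpa using (tendsto_rpow_mul_exp_neg_mul_atTop_nhds_zero (-a) _ hc).const_mul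
      (Real.exp (t * X) * K)

theorem ofReal_cpow_im {x : ℝ} (hx : 0 < x) (p : ℝ) : ((x : ℂ) ^ (p : ℂ)).im = 0 := by
  rw [← Complex.ofReal_cpow hx.le, Complex.ofReal_im]

theorem cpow_ray_zero {θ r : ℝ} (hθ0 : 0 < θ) (hθπ : θ < Real.pi) (hr : 0 < r) (p : ℝ) :
    ray θ 0 r ^ (p : ℂ) = ((r ^ p : ℝ) : ℂ) * Complex.exp (((p * θ : ℝ) : ℂ) * Complex.I) := by
  have h0 : ray θ 0 r = (r : ℂ) * Complex.exp (θ * Complex.I) := by simp [ray]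
  rw [h0, Complex.cpow_def_of_ne_zero (mul_ne_zero (by exact_mod_cast hr.ne') (Complex.exp_ne_zero _)),
    Complex.log_ofReal_mul hr (Complex.exp_ne_zero _), Complex.log_exp (by simp; linarith)
    (by simp; linarith), Real.rpow_def_of_pos hr, add_mul, Complex.exp_add]
  push_cast
  congr 2
  ring

/-- Hankel's formula with the vertex at the origin. -/
theorem hankel_zero {θ t ν : ℝ} (hθ : θ ∈ Ioo (Real.pi / 2) Real.pi) (ht : 0 < t)
    (hν : ν ∈ Ioo (0 : ℝ) 1) :
    (rayInt θ 0 fun s => Complex.exp (t * s) * s ^ ((-ν : ℝ) : ℂ)).im = Real.pi * omegaKer ν t := by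
  have hpi := Real.pi_pos
  have hθ0 : 0 < θ := by linarith [hθ.1]
  have hcos : Real.cos θ < 0 := Real.cos_neg_of_pi_div_two_lt_of_lt hθ.1 (by linarith [hθ.2])
  -- This is `-t exp(iθ)`, written with the angle `θ - π` in `(-π/2, 0)`, so that its principal
  -- power can be read off and its real part is positive.
  set z : ℂ := t * Complex.exp (((θ - Real.pi : ℝ) : ℂ) * Complex.I) with hz
  have hze : z = -(t * Complex.exp (θ * Complex.I)) := by
    rw [hz]; push_cast
    rw [sub_mul, Complex.exp_sub, Complex.exp_pi_mul_I]; ring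
  have hzre : 0 < z.re := by
    rw [hze, Complex.neg_re, Complex.re_ofReal_mul, Complex.exp_ofReal_mul_I_re]; nlinarith
  have h1ν : 0 < 1 - ν := by linarith [hν.2]
  have hint : (rayInt θ 0 fun s => Complex.exp (t * s) * s ^ ((-ν : ℝ) : ℂ)) =
      Complex.exp ((((1 - ν) * θ : ℝ) : ℂ) * Complex.I) *
        ∫ r in Ioi (0 : ℝ), ((r ^ ((1 - ν) - 1) : ℝ) : ℂ) * Complex.exp (-z * r) := by
    rw [rayInt, ← integral_const_mul]
    refine setIntegral_congr_fun measurableSet_Ioi fun r hr => ?_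
    rw [cpow_ray_zero hθ0 hθ.2 hr, hze, ray, show 1 - ν - 1 = -ν by ring]
    have e : Complex.exp ((((1 - ν) * θ : ℝ) : ℂ) * Complex.I) =
        Complex.exp (θ * Complex.I) * Complex.exp (((-ν * θ : ℝ) : ℂ) * Complex.I) := by
      rw [← Complex.exp_add]; push_cast; congr 1; ring
    rw [e, show (t : ℂ) * ((0 : ℝ) + r * Complex.exp (θ * Complex.I)) =
      - -(t * Complex.exp (θ * Complex.I)) * r by push_cast; ring]
    ring
  have hzpow : z ^ (-((1 - ν : ℝ) : ℂ)) =
      ((t ^ (-(1 - ν)) : ℝ) : ℂ) *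
        Complex.exp (((-(1 - ν) * (θ - Real.pi) : ℝ) : ℂ) * Complex.I) := by
    have hne := Complex.exp_ne_zero (((θ - Real.pi : ℝ) : ℂ) * Complex.I)
    rw [hz, Complex.cpow_def_of_ne_zero (mul_ne_zero (by exact_mod_cast ht.ne') hne),
      Complex.log_ofReal_mul ht hne, Complex.log_exp (by simp; linarith)
      (by simp; linarith [hθ.2]), Real.rpow_def_of_pos ht, add_mul, Complex.exp_add]
    push_cast
    congr 2
    ring
  -- The imaginary part will be `Γ(1-ν) t^(ν-1) sin(πν)`, which the reflection formula turns into `π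
  -- t^(ν-1) / Γ(ν)`.
  have hrefl := Real.Gamma_mul_Gamma_one_sub ν
  have hsin : 0 < Real.sin (Real.pi * ν) :=
    Real.sin_pos_of_pos_of_lt_pi (mul_pos hpi hν.1) (by nlinarith [hν.2])
  have hΓ := Real.Gamma_pos_of_pos hν.1
  rw [hint, integral_rpow_mul_cexp h1ν hzre, hzpow]
  have e : Complex.exp ((((1 - ν) * θ : ℝ) : ℂ) * Complex.I) * ((Real.Gamma (1 - ν) : ℂ) *
      (((t ^ (-(1 - ν)) : ℝ) : ℂ) *
        Complex.exp (((-(1 - ν) * (θ - Real.pi) : ℝ) : ℂ) * Complex.I))) =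
      ((Real.Gamma (1 - ν) * t ^ (-(1 - ν)) : ℝ) : ℂ) *
        Complex.exp (((Real.pi - Real.pi * ν : ℝ) : ℂ) * Complex.I) := by
    have : Complex.exp (((Real.pi - Real.pi * ν : ℝ) : ℂ) * Complex.I) =
        Complex.exp ((((1 - ν) * θ : ℝ) : ℂ) * Complex.I) *
          Complex.exp (((-(1 - ν) * (θ - Real.pi) : ℝ) : ℂ) * Complex.I) := by
      rw [← Complex.exp_add]; push_cast; congr 1; ring
    rw [this]; push_cast; ring
  rw [e, Complex.im_ofReal_mul, Complex.exp_ofReal_mul_I_im, Real.sin_pi_sub, omegaKer,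
    show -(1 - ν) = ν - 1 by ring]
  rw [eq_div_iff hsin.ne'] at hrefl
  rw [mul_div_assoc', eq_div_iff hΓ.ne']
  linear_combination t ^ (ν - 1) * hrefl

section vertex

variable {θ t R : ℝ}

theorem norm_cpow_neg_le {ν : ℝ} (hθ : 0 < Real.sin θ) (hR : 0 < R) (hν : 0 ≤ ν) (r : ℝ) :
    ‖ray θ R r ^ ((-ν : ℝ) : ℂ)‖ ≤ (R * Real.sin θ) ^ (-ν) := by
  rw [Complex.norm_cpow_real]
  exact Real.rpow_le_rpow_of_nonpos (by positivity) (sin_mul_le_norm_ray' hθ hR.le) (by linarith)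

theorem continuousOn_cpow_ray (hθ : 0 < Real.sin θ) (hR : 0 < R) (c : ℂ) :
    ContinuousOn (fun r => ray θ R r ^ c) (Ici 0) := by
  intro r hr
  have h : ContinuousAt (fun r => ray θ R r) r :=
    ((continuous_ray θ).comp (Continuous.prodMk_right R)).continuousAt
  exact (h.cpow continuousAt_const
    (ray_mem_slitPlane hθ hr (by linarith [show (0 : ℝ) ≤ r from hr]))).continuousWithinAt

theorem continuous_cexp_ray (θ t R : ℝ) : Continuous fun r => Complex.exp (t * ray θ R r) := by
  unfold ray; fun_prop

theorem integrableOn_exp_ray (hθ : Real.cos θ < 0) (ht : 0 < t) :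
    IntegrableOn (fun r => Real.exp (-(-(t * Real.cos θ)) * r)) (Ioi 0) := by
  have := integrableOn_rpow_mul_exp (p := 0) (c := -(t * Real.cos θ)) (by norm_num) (by nlinarith)
  simpa using this

/-- Integrability along a ray of `exp (t s) W(s)` with `W` bounded. -/
theorem integrableOn_cexp_mul_ray {W : ℂ → ℂ} {K : ℝ} (hθ : Real.cos θ < 0) (ht : 0 < t)
    (hc : ContinuousOn (fun r => W (ray θ R r)) (Ioi 0)) (hW : ∀ r, 0 < r → ‖W (ray θ R r)‖ ≤ K) :
    IntegrableOn (fun r => Complex.exp (θ * Complex.I) *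
      (Complex.exp (t * ray θ R r) * W (ray θ R r))) (Ioi 0) ∧
    ‖rayInt θ R fun s => Complex.exp (t * s) * W s‖ ≤
      K * ∫ r in Ioi (0 : ℝ), Real.exp (t * R) * Real.exp (-(-(t * Real.cos θ)) * r) := by
  have hb : ∀ r, 0 < r → ‖Complex.exp (θ * Complex.I) *
      (Complex.exp (t * ray θ R r) * W (ray θ R r))‖ ≤
      K * (Real.exp (t * R) * Real.exp (-(-(t * Real.cos θ)) * r)) := by
    intro r hr
    rw [norm_mul, norm_mul, norm_exp_mul_I, norm_cexp_ray, one_mul, mul_comm K]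
    gcongr
    exact hW r hr
  have hi : IntegrableOn (fun r => K * (Real.exp (t * R) * Real.exp (-(-(t * Real.cos θ)) * r)))
      (Ioi 0) := ((integrableOn_exp_ray hθ ht).const_mul _).const_mul _
  constructor
  · refine Integrable.mono' hi ?_ ?_
    · exact (continuousOn_const.mul ((continuous_cexp_ray θ t R).continuousOn.mul
        hc)).aestronglyMeasurable measurableSet_Ioi
    · filter_upwards [ae_restrict_mem measurableSet_Ioi] with r hr using hb r hr
  · rw [← integral_const_mul]
    refine norm_integral_le_of_norm_le hi ?_
    filter_upwards [ae_restrict_mem measurableSet_Ioi] with r hr using hb r hr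

/-- Integration by parts along the ray: the boundary term at infinity vanishes and the one at the
vertex `R` is real. A positive vertex is needed because `s ^ (-(ν + 1))` is not integrable at the
origin. -/
theorem hankel_succ {ν : ℝ} (hθ : θ ∈ Ioo (Real.pi / 2) Real.pi) (ht : 0 < t) (hR : 0 < R)
    (hν : 0 ≤ ν) :
    ν * (rayInt θ R fun s => Complex.exp (t * s) * s ^ ((-(ν + 1) : ℝ) : ℂ)).im =
      t * (rayInt θ R fun s => Complex.exp (t * s) * s ^ ((-ν : ℝ) : ℂ)).im := by
  have hpi := Real.pi_pos
  have hsin : 0 < Real.sin θ := Real.sin_pos_of_pos_of_lt_pi (by linarith [hθ.1]) hθ.2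
  have hcos : Real.cos θ < 0 := Real.cos_neg_of_pi_div_two_lt_of_lt hθ.1 (by linarith [hθ.2])
  have i0 := (integrableOn_cexp_mul_ray (W := fun s => s ^ ((-ν : ℝ) : ℂ)) hcos ht
    ((continuousOn_cpow_ray hsin hR ((-ν : ℝ) : ℂ)).mono Ioi_subset_Ici_self)
    (fun r _ => norm_cpow_neg_le hsin hR hν r)).1
  have i1 := (integrableOn_cexp_mul_ray (W := fun s => s ^ ((-(ν + 1) : ℝ) : ℂ)) hcos ht
    ((continuousOn_cpow_ray hsin hR ((-(ν + 1) : ℝ) : ℂ)).mono Ioi_subset_Ici_self)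
    (fun r _ => norm_cpow_neg_le hsin hR (by linarith : 0 ≤ ν + 1) r)).1
  set e : ℂ := Complex.exp (θ * Complex.I) with he
  have hderiv : ∀ r ∈ Ici (0 : ℝ), HasDerivAt
      (fun r => Complex.exp (t * ray θ R r) * ray θ R r ^ ((-ν : ℝ) : ℂ))
      (t * (e * (Complex.exp (t * ray θ R r) * ray θ R r ^ ((-ν : ℝ) : ℂ))) -
        ν * (e * (Complex.exp (t * ray θ R r) * ray θ R r ^ ((-(ν + 1) : ℝ) : ℂ)))) r := by
    intro r hr
    have h0 : HasDerivAt (fun r : ℝ => ray θ R r) e r := by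
      have := ((Complex.ofRealCLM.hasDerivAt (x := r)).mul_const e).const_add (R : ℂ)
      simpa [ray] using this
    have hmem : ray θ R r ∈ Complex.slitPlane :=
      ray_mem_slitPlane hsin hr (by linarith [show (0 : ℝ) ≤ r from hr])
    have h1 : HasDerivAt (fun s : ℂ => Complex.exp (t * s) * s ^ ((-ν : ℝ) : ℂ))
        (Complex.exp (t * ray θ R r) * (t * 1) * ray θ R r ^ ((-ν : ℝ) : ℂ) +
          Complex.exp (t * ray θ R r) *
            (((-ν : ℝ) : ℂ) * ray θ R r ^ (((-ν : ℝ) : ℂ) - 1) * 1)) (ray θ R r) :=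
      (((hasDerivAt_id _).const_mul (t : ℂ)).cexp).mul ((hasDerivAt_id _).cpow_const hmem)
    refine (HasDerivAt.comp_of_eq r h1 h0 rfl).congr_deriv ?_
    rw [show ((-(ν + 1) : ℝ) : ℂ) = ((-ν : ℝ) : ℂ) - 1 by push_cast; ring]
    push_cast
    ring
  have hc : 0 < -(t * Real.cos θ) := by nlinarith
  have hlim : Filter.Tendsto
      (fun r => Complex.exp (t * ray θ R r) * ray θ R r ^ ((-ν : ℝ) : ℂ)) Filter.atTop (nhds 0) := by
    have h1 : Filter.Tendsto (fun r : ℝ => Real.exp (t * R) * (R * Real.sin θ) ^ (-ν) *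
        (r ^ (0 : ℝ) * Real.exp (-(-(t * Real.cos θ)) * r))) Filter.atTop (nhds 0) := by
      simpa using (tendsto_rpow_mul_exp_neg_mul_atTop_nhds_zero 0 _ hc).const_mul
        (Real.exp (t * R) * (R * Real.sin θ) ^ (-ν))
    refine squeeze_zero_norm (fun r => ?_) h1
    rw [norm_mul, norm_cexp_ray, Real.rpow_zero, one_mul]
    calc _ ≤ Real.exp (t * R) * Real.exp (-(-(t * Real.cos θ)) * r) *
          (R * Real.sin θ) ^ (-ν) := by
          gcongr; exact norm_cpow_neg_le hsin hR hν r
      _ = _ := by ring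
  have key := integral_Ioi_of_hasDerivAt_of_tendsto
    (hderiv 0 self_mem_Ici).continuousAt.continuousWithinAt (fun r hr => hderiv r (Ioi_subset_Ici_self hr))
    ((i0.const_mul (t : ℂ)).sub (i1.const_mul (ν : ℂ))) hlim
  rw [integral_sub (i0.const_mul (t : ℂ)) (i1.const_mul (ν : ℂ)), integral_const_mul (t : ℂ),
    integral_const_mul (ν : ℂ), ray_zero_right] at key
  have him := congrArg Complex.im key
  have hend : (0 - Complex.exp ((t : ℂ) * R) * (R : ℂ) ^ ((-ν : ℝ) : ℂ)).im = 0 := by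
    rw [show Complex.exp ((t : ℂ) * R) = ((Real.exp (t * R) : ℝ) : ℂ) by push_cast; rfl,
      ← Complex.ofReal_cpow hR.le, ← Complex.ofReal_mul, zero_sub, Complex.neg_im,
      Complex.ofReal_im, neg_zero]
  rw [hend, Complex.sub_im, Complex.im_ofReal_mul, Complex.im_ofReal_mul] at him
  simp only [rayInt]
  linarith

theorem hankel_lt_one {ν : ℝ} (hθ : θ ∈ Ioo (Real.pi / 2) Real.pi) (ht : 0 < t) (hR : 0 < R)
    (hν : ν ∈ Ioo (0 : ℝ) 1) :
    (rayInt θ R fun s => Complex.exp (t * s) * s ^ ((-ν : ℝ) : ℂ)).im =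
      Real.pi * omegaKer ν t := by
  have hpi := Real.pi_pos
  have hsin : 0 < Real.sin θ := Real.sin_pos_of_pos_of_lt_pi (by linarith [hθ.1]) hθ.2
  have hcos : Real.cos θ < 0 := Real.cos_neg_of_pi_div_two_lt_of_lt hθ.1 (by linarith [hθ.2])
  rw [← hankel_zero hθ ht hν]
  refine rayInt_im_cexp_mul_eq_zero (K := Real.sin θ ^ (-ν)) (a := ν) hcos ht hR hν.2 ?_ ?_ ?_
  · intro x r hx hr h
    exact ((hasDerivAt_id _).cpow_const (ray_mem_slitPlane hsin hr h)).differentiableAt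
  · intro x hx
    exact ofReal_cpow_im hx _
  · intro x hx r hr
    rw [Complex.norm_cpow_real, ← Real.mul_rpow hsin.le hr.le, mul_comm (Real.sin θ)]
    exact Real.rpow_le_rpow_of_nonpos (by positivity) (sin_mul_le_norm_ray hsin hr.le)
      (by linarith [hν.1])

/-- The value `1` is out of reach of both the formula at the origin, which needs `ν < 1`, and the
recursion, whose left side vanishes at `ν = 0`. It is obtained by continuity as `ν` increases to
`1`. -/
theorem hankel_one (hθ : θ ∈ Ioo (Real.pi / 2) Real.pi) (ht : 0 < t) (hR : 0 < R) :
    (rayInt θ R fun s => Complex.exp (t * s) * s ^ ((-1 : ℝ) : ℂ)).im =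
      Real.pi * omegaKer 1 t := by
  have hpi := Real.pi_pos
  have hsin : 0 < Real.sin θ := Real.sin_pos_of_pos_of_lt_pi (by linarith [hθ.1]) hθ.2
  have hcos : Real.cos θ < 0 := Real.cos_neg_of_pi_div_two_lt_of_lt hθ.1 (by linarith [hθ.2])
  have hl : (nhdsWithin (1 : ℝ) (Iio 1)) ≤ nhds 1 := nhdsWithin_le_nhds
  have hmem : ∀ᶠ ν in nhdsWithin (1 : ℝ) (Iio 1), ν ∈ Ioo (0 : ℝ) 1 := Ioo_mem_nhdsLT one_pos
  have h1 : Filter.Tendsto (fun ν : ℝ => rayInt θ R fun s => Complex.exp (t * s) * s ^ ((-ν : ℝ) : ℂ))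
      (nhdsWithin 1 (Iio 1))
      (nhds (rayInt θ R fun s => Complex.exp (t * s) * s ^ ((-1 : ℝ) : ℂ))) := by
    refine tendsto_integral_filter_of_dominated_convergence
      (fun r => (1 + (R * Real.sin θ)⁻¹) * Real.exp (t * R) * Real.exp (-(-(t * Real.cos θ)) * r))
      ?_ ?_ ((integrableOn_exp_ray hcos ht).const_mul _) ?_
    · refine Filter.Eventually.of_forall fun ν => ?_
      exact (continuousOn_const.mul ((continuous_cexp_ray θ t R).continuousOn.mul
        ((continuousOn_cpow_ray hsin hR _).mono Ioi_subset_Ici_self))).aestronglyMeasurable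
        measurableSet_Ioi
    · filter_upwards [hmem] with ν hν
      refine Filter.Eventually.of_forall fun r => ?_
      have hpos : 0 < R * Real.sin θ := by positivity
      have h2 : (R * Real.sin θ) ^ (-ν) ≤ 1 + (R * Real.sin θ)⁻¹ := by
        rcases le_total 1 (R * Real.sin θ) with h | h
        · have := Real.rpow_le_one_of_one_le_of_nonpos h (by linarith [hν.1] : -ν ≤ 0)
          have : 0 < (R * Real.sin θ)⁻¹ := by positivity
          linarith
        · have := Real.rpow_le_rpow_of_exponent_ge hpos h (by linarith [hν.2] : (-1 : ℝ) ≤ -ν)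
          rw [Real.rpow_neg_one] at this
          linarith
      have h3 := (norm_cpow_neg_le hsin hR hν.1.le r).trans h2
      rw [norm_mul, norm_mul, norm_exp_mul_I, norm_cexp_ray, one_mul]
      calc _ ≤ Real.exp (t * R) * Real.exp (-(-(t * Real.cos θ)) * r) *
            (1 + (R * Real.sin θ)⁻¹) := by gcongr
        _ = _ := by ring
    · filter_upwards [ae_restrict_mem measurableSet_Ioi] with r hr
      have h4 : ContinuousAt (fun ν : ℝ => ray θ R r ^ ((-ν : ℝ) : ℂ)) 1 := by
        have hne := ray_ne_zero (x := R) hsin (le_of_lt hr) (by linarith [show (0 : ℝ) < r from hr])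
        exact (Continuous.const_cpow (by fun_prop) (Or.inl hne)).continuousAt
      exact (((continuousAt_const.mul h4).const_mul _).tendsto).mono_left hl
  have h2 := (Complex.continuous_im.tendsto _).comp h1
  have h3 : Filter.Tendsto (fun ν => Real.pi * omegaKer ν t) (nhdsWithin 1 (Iio 1))
      (nhds (Real.pi * omegaKer 1 t)) := by
    have h4 : ContinuousAt (fun ν : ℝ => omegaKer ν t) 1 := by
      unfold omegaKer
      refine ContinuousAt.div ?_ ?_ (by simp)
      · exact (Continuous.rpow continuous_const (by fun_prop) fun _ => Or.inl ht.ne').continuousAt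
      · refine (Real.differentiableAt_Gamma fun m => ?_).continuousAt
        have : (0 : ℝ) ≤ m := m.cast_nonneg
        linarith
    exact ((continuousAt_const.mul h4).tendsto).mono_left hl
  refine tendsto_nhds_unique h2 (h3.congr' ?_)
  filter_upwards [hmem] with ν hν
  exact (hankel_lt_one hθ ht hR hν).symm

/-- Hankel's integral for the reciprocal Gamma function. -/
theorem hankel {ν : ℝ} (hθ : θ ∈ Ioo (Real.pi / 2) Real.pi) (ht : 0 < t) (hR : 0 < R)
    (hν : 0 < ν) :
    (rayInt θ R fun s => Complex.exp (t * s) * s ^ ((-ν : ℝ) : ℂ)).im =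
      Real.pi * omegaKer ν t := by
  obtain ⟨n, hn⟩ := exists_nat_ge ν
  induction n generalizing ν with
  | zero => exact absurd hν (not_lt.2 (by simpa using hn))
  | succ n ih =>
    rcases lt_trichotomy ν 1 with h | rfl | h
    · exact hankel_lt_one hθ ht hR ⟨hν, h⟩
    · exact hankel_one hθ ht hR
    · have h0 : 0 < ν - 1 := by linarith
      have h1 := hankel_succ hθ ht hR h0.le
      rw [ih h0 (by push_cast at hn; linarith), sub_add_cancel] at h1
      have h2 : (ν - 1) * omegaKer ν t = t * omegaKer (ν - 1) t := by
        have hΓ := Real.Gamma_add_one h0.ne'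
        have hΓ0 := Real.Gamma_pos_of_pos h0
        have hp := Real.rpow_add_one ht.ne' (ν - 1 - 1)
        rw [sub_add_cancel] at hΓ hp
        unfold omegaKer
        rw [hΓ, hp]
        field_simp
      apply mul_left_cancel₀ h0.ne'
      rw [h1]
      linear_combination -Real.pi * h2

end vertex

/-! ### Laplace symbols and the Mittag-Leffler series -/

/-- If `φ ∈ [0, αθ]` is the argument of `s^α`, rotation by `-φ/2` places `s^α` and `l` at the angles
`±φ/2`. The real part of the rotated sum is `(|s|^α + l) cos(φ/2)`, and `αθ < π` allows the
comparison of cosines. -/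
theorem cos_mul_le_norm_cpow_add {α θ l x r : ℝ} (hα : 0 < α) (hθ0 : 0 < θ) (hθπ : θ < Real.pi)
    (hαθ : α * θ < Real.pi) (hl : 0 ≤ l) (hx : 0 ≤ x) (hr : 0 ≤ r) (h : 0 < x + r) :
    Real.cos (α * θ / 2) * (‖ray θ x r‖ ^ α + l) ≤ ‖ray θ x r ^ (α : ℂ) + l‖ := by
  set s := ray θ x r with hs
  have hsin : 0 < Real.sin θ := Real.sin_pos_of_pos_of_lt_pi hθ0 hθπ
  have harg0 : 0 ≤ s.arg := arg_ray_nonneg hsin hr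
  have harg : s.arg ≤ θ := arg_ray_le hθ0 hθπ hx hr h
  set φ : ℝ := s.arg * α with hφ
  have hφ0 : 0 ≤ φ := by positivity
  have hφ1 : φ ≤ α * θ := by rw [hφ, mul_comm]; gcongr
  have h1 : ((s ^ (α : ℂ) + l) * Complex.exp (((-(φ / 2) : ℝ) : ℂ) * Complex.I)).re =
      (‖s‖ ^ α + l) * Real.cos (φ / 2) := by
    rw [Complex.cpow_ofReal, Complex.mul_re, Complex.exp_ofReal_mul_I_re,
      Complex.exp_ofReal_mul_I_im, Real.cos_neg, Real.sin_neg, ← hφ]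
    have hc : Real.cos (φ / 2) = Real.cos φ * Real.cos (φ / 2) + Real.sin φ * Real.sin (φ / 2) := by
      rw [← Real.cos_sub]; congr 1; ring
    simp only [Complex.add_re, Complex.add_im,
      Complex.ofReal_re, Complex.ofReal_im, Complex.mul_re, Complex.mul_im, Complex.I_re,
      Complex.I_im]
    linear_combination -(‖s‖ ^ α) * hc
  have h2 := Complex.re_le_norm ((s ^ (α : ℂ) + l) * Complex.exp (((-(φ / 2) : ℝ) : ℂ) * Complex.I))
  rw [h1, norm_mul, norm_exp_mul_I, mul_one] at h2
  refine le_trans ?_ h2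
  rw [mul_comm]
  refine mul_le_mul_of_nonneg_left ?_ (by positivity)
  exact Real.cos_le_cos_of_nonneg_of_le_pi (by positivity) (by linarith) (by linarith)

/-- The Laplace symbol of `t ^ (μ - 1) E_{α, μ} (-l t ^ α)`. -/
def symbol (α l μ : ℝ) (s : ℂ) : ℂ := s ^ ((α - μ : ℝ) : ℂ) / (s ^ (α : ℂ) + l)

/-- The directions `θ` for which no pole of the symbols lies on or to the right of the rays. -/
structure Admissible (α θ : ℝ) : Prop where
  mem : θ ∈ Ioo (Real.pi / 2) Real.pi
  mul_lt : α * θ < Real.pi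

theorem exists_admissible {α : ℝ} (hα : α ∈ Ioo (1 : ℝ) 2) : ∃ θ, Admissible α θ := by
  have hpi := Real.pi_pos
  have h1 : Real.pi / 2 < Real.pi / α :=
    div_lt_div_of_pos_left hpi (by linarith [hα.1]) hα.2
  have h2 : Real.pi / α < Real.pi := div_lt_self hpi hα.1
  -- The midpoint of the interval `(π/2, π/α)`, which is nonempty because `α < 2` and lies below `π`
  -- because `α > 1`.
  refine ⟨(Real.pi / 2 + Real.pi / α) / 2, ⟨by linarith, by linarith⟩, ?_⟩
  have h3 : (Real.pi / 2 + Real.pi / α) / 2 < Real.pi / α := by linarith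
  rw [lt_div_iff₀ (by linarith [hα.1])] at h3
  linarith

section symbol

variable {α θ l μ x r : ℝ}

theorem Admissible.pos (h : Admissible α θ) : 0 < θ := by linarith [h.mem.1, Real.pi_pos]

theorem Admissible.sin_pos (h : Admissible α θ) : 0 < Real.sin θ :=
  Real.sin_pos_of_pos_of_lt_pi h.pos h.mem.2

theorem Admissible.cos_neg (h : Admissible α θ) : Real.cos θ < 0 :=
  Real.cos_neg_of_pi_div_two_lt_of_lt h.mem.1 (by linarith [h.mem.2, Real.pi_pos])

theorem Admissible.cos_half_pos (h : Admissible α θ) (hα : 0 < α) : 0 < Real.cos (α * θ / 2) := by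
  have := mul_pos hα h.pos
  exact Real.cos_pos_of_mem_Ioo ⟨by linarith [Real.pi_pos], by linarith [h.mul_lt]⟩

theorem denom_ne_zero (h : Admissible α θ) (hα : 0 < α) (hl : 0 < l) (hx : 0 ≤ x) (hr : 0 ≤ r)
    (hxr : 0 < x + r) : ray θ x r ^ (α : ℂ) + l ≠ 0 := by
  rw [← norm_pos_iff]
  refine lt_of_lt_of_le ?_ (cos_mul_le_norm_cpow_add hα h.pos h.mem.2 h.mul_lt hl.le hx hr hxr)
  have := h.cos_half_pos hα
  positivity

theorem norm_symbol_le (h : Admissible α θ) (hα : 0 < α) (hl : 0 < l) (hx : 0 ≤ x) (hr : 0 ≤ r)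
    (hxr : 0 < x + r) : ‖symbol α l μ (ray θ x r)‖ ≤
      ‖ray θ x r‖ ^ (α - μ) / (Real.cos (α * θ / 2) * (‖ray θ x r‖ ^ α + l)) := by
  have hc := h.cos_half_pos hα
  rw [symbol, norm_div, Complex.norm_cpow_real]
  gcongr
  exact cos_mul_le_norm_cpow_add hα h.pos h.mem.2 h.mul_lt hl.le hx hr hxr

/-- A qualitative bound: the constant depends on `l`, but the exponent `-1/2` is integrable at the
origin. It justifies the vertex at `0` and differentiation under the integral; the bound with the
right dependence on `l` is `norm_modeSymbol_le`. -/
theorem norm_symbol_le_rpow_neg_half (h : Admissible α θ) (hα : 0 < α) (hl : 0 < l)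
    (hμ : μ ∈ Icc (1 / 2) (α + 1 / 2)) (hx : 0 ≤ x) (hr : 0 ≤ r) (hxr : 0 < x + r) :
    ‖symbol α l μ (ray θ x r)‖ ≤
      (1 + 1 / l) / Real.cos (α * θ / 2) * ‖ray θ x r‖ ^ (-(1 / 2) : ℝ) := by
  refine (norm_symbol_le h hα hl hx hr hxr).trans ?_
  have hc := h.cos_half_pos hα
  have hy : 0 < ‖ray θ x r‖ := norm_pos_iff.2 (ray_ne_zero h.sin_pos hr hxr)
  set y := ‖ray θ x r‖
  have h1 : y ^ (α - μ) = y ^ (-(1 / 2) : ℝ) * y ^ (α - μ + 1 / 2) := by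
    rw [← Real.rpow_add hy]; congr 1; ring
  have h2 : y ^ (α - μ + 1 / 2) ≤ 1 + y ^ α := by
    rcases le_total y 1 with h | h
    · have := Real.rpow_le_one hy.le h (by linarith [hμ.2] : 0 ≤ α - μ + 1 / 2)
      have := Real.rpow_pos_of_pos hy α
      linarith
    · have := Real.rpow_le_rpow_of_exponent_le h (by linarith [hμ.1] : α - μ + 1 / 2 ≤ α)
      linarith
  have h3 : 1 + y ^ α ≤ (1 + 1 / l) * (y ^ α + l) := by
    have e : (1 + 1 / l) * (y ^ α + l) = 1 + y ^ α + (y ^ α / l + l) := by field_simp; ring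
    have : 0 ≤ y ^ α / l + l := by positivity
    linarith
  rw [div_le_iff₀ (by positivity), h1]
  calc y ^ (-(1 / 2) : ℝ) * y ^ (α - μ + 1 / 2)
      ≤ y ^ (-(1 / 2) : ℝ) * ((1 + 1 / l) * (y ^ α + l)) := by
        gcongr; exact h2.trans h3
    _ = _ := by field_simp

theorem differentiableAt_symbol (h : Admissible α θ) (hα : 0 < α) (hl : 0 < l) (hx : 0 ≤ x)
    (hr : 0 ≤ r) (hxr : 0 < x + r) : DifferentiableAt ℂ (symbol α l μ) (ray θ x r) := by
  have hm := ray_mem_slitPlane h.sin_pos hr hxr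
  have hp : ∀ c : ℂ, DifferentiableAt ℂ (fun s : ℂ => s ^ c) (ray θ x r) := fun c =>
    ((hasDerivAt_id _).cpow_const hm).differentiableAt
  exact (hp _).div ((hp _).add_const _) (denom_ne_zero h hα hl hx hr hxr)

theorem continuousOn_symbol_ray (h : Admissible α θ) (hα : 0 < α) (hl : 0 < l) (hx : 0 ≤ x) :
    ContinuousOn (fun r => symbol α l μ (ray θ x r)) (Ioi 0) := by
  intro r hr
  have h1 := (differentiableAt_symbol (μ := μ) h hα hl hx (le_of_lt hr)
    (by linarith [show (0 : ℝ) < r from hr])).continuousAt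
  exact (ContinuousAt.comp (f := fun r => ray θ x r) h1
    ((continuous_ray θ).comp (Continuous.prodMk_right x)).continuousAt).continuousWithinAt

theorem symbol_im {y : ℝ} (hy : 0 < y) : (symbol α l μ y).im = 0 := by
  rw [symbol, ← Complex.ofReal_cpow hy.le, ← Complex.ofReal_cpow hy.le, ← Complex.ofReal_add,
    ← Complex.ofReal_div, Complex.ofReal_im]

/-- One step of the geometric expansion of `s^(-μ) / (1 + l s^(-α))`. -/
theorem cpow_neg_mul_symbol {s : ℂ} (hs : s ≠ 0) (hd : s ^ (α : ℂ) + l ≠ 0) (c : ℝ) :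
    s ^ ((-c : ℝ) : ℂ) * symbol α l μ s =
      s ^ ((-(c + μ) : ℝ) : ℂ) - l * (s ^ ((-(c + α) : ℝ) : ℂ) * symbol α l μ s) := by
  have h1 : s ^ ((-c : ℝ) : ℂ) = s ^ ((-(c + α) : ℝ) : ℂ) * s ^ (α : ℂ) := by
    rw [← Complex.cpow_add _ _ hs]; congr 1; push_cast; ring
  have h2 : s ^ ((-(c + μ) : ℝ) : ℂ) = s ^ ((-(c + α) : ℝ) : ℂ) * s ^ ((α - μ : ℝ) : ℂ) := by
    rw [← Complex.cpow_add _ _ hs]; congr 1; push_cast; ring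
  rw [h1, h2, symbol]
  field_simp
  ring

/-- The ray integral of the symbol is the sum of the Mittag-Leffler series. -/
theorem tendsto_mittagLeffler {t : ℝ} (h : Admissible α θ) (hα : 0 < α) (hl : 0 < l)
    (hμ : μ ∈ Icc (1 / 2) (α + 1 / 2)) (ht : 0 < t) :
    Filter.Tendsto (fun N : ℕ => ∑ k ∈ Finset.range N, (-l) ^ k * omegaKer (α * k + μ) t)
      Filter.atTop
      (nhds (Real.pi⁻¹ * (rayInt θ 0 fun s => Complex.exp (t * s) * symbol α l μ s).im)) := by
  have hpi := Real.pi_pos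
  have hsin := h.sin_pos
  have hcos := h.cos_neg
  have hc := h.cos_half_pos hα
  have hμ0 : 0 < μ := by linarith [hμ.1]
  -- On the ray from this vertex `|s|^α ≥ 2 l`, so the geometric expansion of the symbol has ratio
  -- at most `1/2`.
  set R : ℝ := (2 * l) ^ (1 / α) / Real.sin θ with hRdef
  have hR : 0 < R := by positivity
  have hRs : R * Real.sin θ = (2 * l) ^ (1 / α) := by rw [hRdef]; field_simp
  set K : ℝ := (1 + 1 / l) / Real.cos (α * θ / 2) with hK
  have hK0 : 0 ≤ K := by positivity
  -- Up to the factor `(-l)^N / π`, this is the remainder after `N` terms of the series.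
  set Q : ℕ → ℝ := fun N =>
    (rayInt θ R fun s => Complex.exp (t * s) * (s ^ ((-(α * N) : ℝ) : ℂ) * symbol α l μ s)).im with hQ
  have hbound : ∀ N : ℕ, ∀ r, 0 < r →
      ‖ray θ R r ^ ((-(α * N) : ℝ) : ℂ) * symbol α l μ (ray θ R r)‖ ≤
        (R * Real.sin θ) ^ (-(α * N)) * (K * (R * Real.sin θ) ^ (-(1 / 2) : ℝ)) := by
    intro N r hr
    rw [norm_mul]
    refine mul_le_mul (norm_cpow_neg_le hsin hR (by positivity) r) ?_ (norm_nonneg _) (by positivity)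
    refine (norm_symbol_le_rpow_neg_half h hα hl hμ hR.le hr.le (by linarith)).trans ?_
    refine mul_le_mul_of_nonneg_left ?_ hK0
    exact Real.rpow_le_rpow_of_nonpos (by positivity) (sin_mul_le_norm_ray' hsin hR.le) (by norm_num)
  have hint : ∀ N : ℕ, _ := fun N => integrableOn_cexp_mul_ray
    (W := fun s => s ^ ((-(α * N) : ℝ) : ℂ) * symbol α l μ s) hcos ht
    (((continuousOn_cpow_ray hsin hR _).mono Ioi_subset_Ici_self).mul
      (continuousOn_symbol_ray h hα hl hR.le)) (hbound N)
  have hstep : ∀ N : ℕ, Q N = Real.pi * omegaKer (α * N + μ) t - l * Q (N + 1) := by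
    intro N
    have hν : 0 < α * N + μ := by positivity
    have hi := (integrableOn_cexp_mul_ray (W := fun s => s ^ ((-(α * N + μ) : ℝ) : ℂ)) hcos ht
      ((continuousOn_cpow_ray hsin hR _).mono Ioi_subset_Ici_self)
      (fun r _ => norm_cpow_neg_le hsin hR hν.le r)).1
    rw [← hankel h.mem ht hR hν]
    simp only [hQ]
    rw [← Complex.im_ofReal_mul, ← Complex.sub_im]
    congr 1
    simp only [rayInt]
    rw [← integral_const_mul, ← integral_sub hi ((hint (N + 1)).1.const_mul _)]
    refine setIntegral_congr_fun measurableSet_Ioi fun r hr => ?_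
    have hr' : (0 : ℝ) < r := hr
    have h1 := cpow_neg_mul_symbol (μ := μ) (ray_ne_zero hsin hr'.le (by linarith))
      (denom_ne_zero (x := R) h hα hl hR.le hr'.le (by linarith)) (α * N)
    have h2 : α * ((N + 1 : ℕ) : ℝ) = α * N + α := by push_cast; ring
    rw [h2, h1]
    ring
  have hsum : ∀ N : ℕ, ∑ k ∈ Finset.range N, (-l) ^ k * omegaKer (α * k + μ) t =
      Real.pi⁻¹ * Q 0 - Real.pi⁻¹ * ((-l) ^ N * Q N) := by
    intro N
    induction N with
    | zero => simp
    | succ N ih =>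
      rw [Finset.sum_range_succ, ih, hstep N]
      field_simp
      ring
  -- The expansion needs a vertex away from `0`, whereas the estimates in `t` need the vertex `0`.
  -- The imaginary part is the same for both.
  have hQ0 : Q 0 = (rayInt θ 0 fun s => Complex.exp (t * s) * symbol α l μ s).im := by
    have e : Q 0 = (rayInt θ R fun s => Complex.exp (t * s) * symbol α l μ s).im := by
      simp [hQ]
    rw [e]
    refine rayInt_im_cexp_mul_eq_zero (K := K * Real.sin θ ^ (-(1 / 2) : ℝ)) (a := 1 / 2) hcos ht hR
      (by norm_num) (fun x r hx hr hxr => differentiableAt_symbol h hα hl hx hr hxr)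
      (fun x hx => symbol_im hx) ?_
    intro x hx r hr
    refine (norm_symbol_le_rpow_neg_half h hα hl hμ hx hr.le (by linarith)).trans ?_
    rw [mul_assoc, ← Real.mul_rpow hsin.le hr.le, mul_comm (Real.sin θ)]
    refine mul_le_mul_of_nonneg_left ?_ hK0
    exact Real.rpow_le_rpow_of_nonpos (by positivity) (sin_mul_le_norm_ray hsin hr.le) (by norm_num)
  have hrem : Filter.Tendsto (fun N : ℕ => (-l) ^ N * Q N) Filter.atTop (nhds 0) := by
    set I : ℝ := ∫ r in Ioi (0 : ℝ), Real.exp (t * R) * Real.exp (-(-(t * Real.cos θ)) * r)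
    have hgeo : Filter.Tendsto (fun N : ℕ => (1 / 2 : ℝ) ^ N *
        (K * (R * Real.sin θ) ^ (-(1 / 2) : ℝ) * I)) Filter.atTop (nhds 0) := by
      simpa using (tendsto_pow_atTop_nhds_zero_of_lt_one (by norm_num : (0 : ℝ) ≤ 1 / 2)
        (by norm_num)).mul_const (K * (R * Real.sin θ) ^ (-(1 / 2) : ℝ) * I)
    refine squeeze_zero_norm (fun N => ?_) hgeo
    have h1 : |Q N| ≤ _ := (Complex.abs_im_le_norm _).trans (hint N).2
    have h2 : l ^ N * (R * Real.sin θ) ^ (-(α * N)) = (1 / 2) ^ N := by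
      rw [hRs, ← Real.rpow_mul (by positivity), show 1 / α * -(α * N) = -(N : ℝ) by field_simp,
        Real.rpow_neg (by positivity), Real.rpow_natCast, ← inv_pow, ← mul_pow]
      congr 1; field_simp
    rw [norm_mul, norm_pow, norm_neg, Real.norm_eq_abs, Real.norm_eq_abs, abs_of_pos hl, ← h2]
    calc l ^ N * |Q N| ≤ l ^ N * ((R * Real.sin θ) ^ (-(α * N)) *
          (K * (R * Real.sin θ) ^ (-(1 / 2) : ℝ)) * I) := by gcongr
      _ = _ := by ring
  simp_rw [hsum]
  rw [← hQ0]
  simpa using (tendsto_const_nhds (x := Real.pi⁻¹ * Q 0)).sub (hrem.const_mul Real.pi⁻¹)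

end symbol

/-! ### Derivatives and decay of Laplace inversion integrals -/

section laplace

variable {θ K Λ p : ℝ} {W : ℂ → ℂ}

/-- The `m`-th derivative of the Laplace inversion integral of `W` along the ray from `0`. -/
def laplaceRay (θ : ℝ) (W : ℂ → ℂ) (m : ℕ) (t : ℝ) : ℂ :=
  rayInt θ 0 fun s => Complex.exp (t * s) * (s ^ m * W s)

theorem norm_laplaceRay_integrand_le (hW : ∀ r, 0 < r → ‖W (ray θ 0 r)‖ ≤ K * r ^ p) (m : ℕ)
    (t : ℝ) {r : ℝ} (hr : 0 < r) :
    ‖Complex.exp (θ * Complex.I) *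
      (Complex.exp (t * ray θ 0 r) * (ray θ 0 r ^ m * W (ray θ 0 r)))‖ ≤
      K * (r ^ (m + p) * Real.exp (-(-(t * Real.cos θ)) * r)) := by
  rw [norm_mul, norm_mul, norm_exp_mul_I, norm_cexp_ray, one_mul, norm_mul, norm_pow,
    norm_ray_zero hr.le, mul_zero, Real.exp_zero, one_mul]
  calc _ ≤ Real.exp (-(-(t * Real.cos θ)) * r) * (r ^ m * (K * r ^ p)) := by
        gcongr; exact hW r hr
    _ = _ := by rw [Real.rpow_add hr, Real.rpow_natCast]; ring

theorem aestronglyMeasurable_laplaceRay (hc : ContinuousOn (fun r => W (ray θ 0 r)) (Ioi 0))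
    (m : ℕ) (t : ℝ) : AEStronglyMeasurable (fun r => Complex.exp (θ * Complex.I) *
      (Complex.exp (t * ray θ 0 r) * (ray θ 0 r ^ m * W (ray θ 0 r)))) (volume.restrict (Ioi 0)) := by
  have h : Continuous fun r => ray θ 0 r :=
    (continuous_ray θ).comp (Continuous.prodMk_right 0)
  exact (continuousOn_const.mul ((continuous_cexp_ray θ t 0).continuousOn.mul
    ((h.pow m).continuousOn.mul hc))).aestronglyMeasurable measurableSet_Ioi

theorem integrableOn_laplaceRay (hθ : Real.cos θ < 0) {t : ℝ} (ht : 0 < t)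
    (hc : ContinuousOn (fun r => W (ray θ 0 r)) (Ioi 0))
    (hW : ∀ r, 0 < r → ‖W (ray θ 0 r)‖ ≤ K * r ^ p) (m : ℕ) (hp : 0 < m + p + 1) :
    IntegrableOn (fun r => Complex.exp (θ * Complex.I) *
      (Complex.exp (t * ray θ 0 r) * (ray θ 0 r ^ m * W (ray θ 0 r)))) (Ioi 0) := by
  refine Integrable.mono' (g := fun r => K * (r ^ (m + p) * Real.exp (-(-(t * Real.cos θ)) * r)))
    ?_ (aestronglyMeasurable_laplaceRay hc m t) ?_
  · exact (integrableOn_rpow_mul_exp (by linarith) (by nlinarith)).const_mul _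
  · filter_upwards [ae_restrict_mem measurableSet_Ioi] with r hr
    exact norm_laplaceRay_integrand_le hW m t hr

theorem hasDerivAt_laplaceRay (hθ : Real.cos θ < 0) (hK : 0 ≤ K) (hp : -1 < p)
    (hc : ContinuousOn (fun r => W (ray θ 0 r)) (Ioi 0))
    (hW : ∀ r, 0 < r → ‖W (ray θ 0 r)‖ ≤ K * r ^ p) (m : ℕ) {t : ℝ} (ht : 0 < t) :
    HasDerivAt (laplaceRay θ W m) (laplaceRay θ W (m + 1) t) t := by
  have hm : (0 : ℝ) ≤ m := m.cast_nonneg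
  refine (hasDerivAt_integral_of_dominated_loc_of_deriv_le (𝕜 := ℝ)
    (μ := volume.restrict (Ioi (0 : ℝ)))
    (F := fun t r => Complex.exp (θ * Complex.I) *
      (Complex.exp (t * ray θ 0 r) * (ray θ 0 r ^ m * W (ray θ 0 r))))
    (F' := fun t r => Complex.exp (θ * Complex.I) *
      (Complex.exp (t * ray θ 0 r) * (ray θ 0 r ^ (m + 1) * W (ray θ 0 r))))
    (bound := fun r => K * (r ^ ((m + 1 : ℕ) + p) * Real.exp (-(-(t / 2 * Real.cos θ)) * r)))
    -- Domination is uniform for times above `t / 2`, where the exponential decays at least at the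
    -- rate `t |cos θ| / 2`.
    (Ioi_mem_nhds (by linarith : t / 2 < t))
    (Filter.Eventually.of_forall fun t => aestronglyMeasurable_laplaceRay hc m t)
    (integrableOn_laplaceRay hθ ht hc hW m (by linarith))
    (aestronglyMeasurable_laplaceRay hc (m + 1) t) ?_ ?_ ?_).2
  · filter_upwards [ae_restrict_mem measurableSet_Ioi] with r hr y hy
    have hr' : (0 : ℝ) < r := hr
    refine (norm_laplaceRay_integrand_le hW (m + 1) y hr).trans ?_
    have h1 : y * Real.cos θ ≤ t / 2 * Real.cos θ :=
      mul_le_mul_of_nonpos_right (le_of_lt hy) hθ.le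
    simp only [neg_neg]
    gcongr
  · exact (integrableOn_rpow_mul_exp (by push_cast; linarith) (by nlinarith)).const_mul _
  · filter_upwards with r y _
    have h1 : HasDerivAt (fun y : ℝ => Complex.exp (y * ray θ 0 r))
        (Complex.exp (y * ray θ 0 r) * (1 * ray θ 0 r)) y :=
      ((Complex.ofRealCLM.hasDerivAt (x := y)).mul_const _).cexp
    refine ((h1.mul_const _).const_mul _).congr_deriv ?_
    ring

/-- On the ray from `0` the exponential has modulus `exp(-t |cos θ| r)`, so the majorant is a Gamma
integral and scaling determines the power of `t`. -/
theorem norm_laplaceRay_le (hθ : Real.cos θ < 0) (hW : ∀ r, 0 < r → ‖W (ray θ 0 r)‖ ≤ Λ * r ^ p)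
    (m : ℕ) (hp : 0 < m + p + 1) {t : ℝ} (ht : 0 < t) :
    ‖laplaceRay θ W m t‖ ≤
      Λ * ((-Real.cos θ) ^ (-(m + p + 1)) * Real.Gamma (m + p + 1)) * t ^ (-(m + p + 1)) := by
  have hc : 0 < -(t * Real.cos θ) := by nlinarith
  have h1 := Real.integral_rpow_mul_exp_neg_mul_Ioi hp hc
  have h2 : ‖laplaceRay θ W m t‖ ≤
      ∫ r in Ioi (0 : ℝ), Λ * (r ^ (m + p) * Real.exp (-(-(t * Real.cos θ)) * r)) := by
    refine norm_integral_le_of_norm_le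
      ((integrableOn_rpow_mul_exp (by linarith) hc).const_mul _) ?_
    filter_upwards [ae_restrict_mem measurableSet_Ioi] with r hr
    exact norm_laplaceRay_integrand_le hW m t hr
  refine h2.trans (le_of_eq ?_)
  simp only [add_sub_cancel_right, ← neg_mul] at h1
  rw [integral_const_mul]
  simp only [← neg_mul]
  rw [h1, one_div, Real.inv_rpow (by nlinarith), ← Real.rpow_neg (by nlinarith),
    neg_mul, ← mul_neg, Real.mul_rpow ht.le (by linarith)]
  ring

end laplace

/-! ### Representation and estimates of a single mode -/

/-- Weighted inequality of the means with weights `1/α` and `1 - 1/α`. It is what reduces the factor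
`l` in front of the initial value to `l^(1/α)`, at the price of one power of `r`. -/
theorem rpow_mul_le_rpow_add {α l r : ℝ} (hα : 1 < α) (hl : 0 < l) (hr : 0 < r) :
    r * l ^ (1 - 1 / α) ≤ r ^ α + l := by
  have hα0 : 0 < α := by linarith
  have h1 : 1 / α < 1 := by rw [div_lt_one hα0]; exact hα
  have h := Real.geom_mean_le_arith_mean2_weighted (w₁ := 1 / α) (w₂ := 1 - 1 / α)
    (p₁ := r ^ α) (p₂ := l) (by positivity) (by linarith) (by positivity) hl.le (by ring)
  rw [← Real.rpow_mul hr.le, mul_one_div_cancel hα0.ne', Real.rpow_one] at h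
  have h2 : 1 / α * r ^ α ≤ r ^ α := mul_le_of_le_one_left (by positivity) h1.le
  have h3 : (1 - 1 / α) * l ≤ l :=
    mul_le_of_le_one_left hl.le (by linarith [show 0 < 1 / α by positivity])
  linarith

/-- The Laplace transform of a mode `v` with initial value `a` of `u` and source `b ω_{2-α}`. -/
def modeSymbol (α l a b : ℝ) (s : ℂ) : ℂ :=
  ((-l * a : ℝ) : ℂ) * symbol α l (α / 2 + 1) s + (b : ℂ) * symbol α l (2 - α / 2) s

/-- The derivatives of a mode `v`. -/
def mode (α θ l a b : ℝ) (m : ℕ) (t : ℝ) : ℝ :=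
  Real.pi⁻¹ * (laplaceRay θ (modeSymbol α l a b) m t).im

section mode

variable {α θ l a b : ℝ}

theorem continuousOn_modeSymbol (h : Admissible α θ) (hα : α ∈ Ioo (1 : ℝ) 2) (hl : 0 < l) :
    ContinuousOn (fun r => modeSymbol α l a b (ray θ 0 r)) (Ioi 0) :=
  have hα0 : 0 < α := by linarith [hα.1]
  (continuousOn_const.mul (continuousOn_symbol_ray h hα0 hl le_rfl)).add
    (continuousOn_const.mul (continuousOn_symbol_ray h hα0 hl le_rfl))

theorem exists_norm_modeSymbol_le (h : Admissible α θ) (hα : α ∈ Ioo (1 : ℝ) 2) (hl : 0 < l) :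
    ∃ K, 0 ≤ K ∧ ∀ r, 0 < r →
      ‖modeSymbol α l a b (ray θ 0 r)‖ ≤ K * r ^ (-(1 / 2) : ℝ) := by
  have hα0 : 0 < α := by linarith [hα.1]
  have hc := h.cos_half_pos hα0
  refine ⟨(|(-l * a)| + |b|) * ((1 + 1 / l) / Real.cos (α * θ / 2)), by positivity,
    fun r hr => ?_⟩
  have h1 := norm_symbol_le_rpow_neg_half (μ := α / 2 + 1) (x := 0) h hα0 hl
    ⟨by linarith, by linarith [hα.1]⟩ le_rfl hr.le (by linarith)
  have h2 := norm_symbol_le_rpow_neg_half (μ := 2 - α / 2) (x := 0) h hα0 hl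
    ⟨by linarith [hα.2], by linarith [hα.1]⟩ le_rfl hr.le (by linarith)
  rw [norm_ray_zero hr.le] at h1 h2
  refine (norm_add_le _ _).trans ?_
  rw [norm_mul, norm_mul, Complex.norm_real, Complex.norm_real, Real.norm_eq_abs, Real.norm_eq_abs]
  rw [add_mul, add_mul, mul_assoc, mul_assoc |b|]
  gcongr

/-- Both terms are brought to the same power of `r`: the first by `rpow_mul_le_rpow_add`, the second
by `r^α ≤ r^α + l`. The factor `l^(1/α)` is the source of the lower bound on `γ`. -/
theorem norm_modeSymbol_le (h : Admissible α θ) (hα : α ∈ Ioo (1 : ℝ) 2) (hl : 0 < l) {r : ℝ}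
    (hr : 0 < r) : ‖modeSymbol α l a b (ray θ 0 r)‖ ≤
      (l ^ (1 / α) * |a| + |b|) / Real.cos (α * θ / 2) * r ^ (α / 2 - 2) := by
  have hα0 : 0 < α := by linarith [hα.1]
  have hc := h.cos_half_pos hα0
  have h1 := norm_symbol_le (μ := α / 2 + 1) (x := 0) h hα0 hl le_rfl hr.le (by linarith)
  have h2 := norm_symbol_le (μ := 2 - α / 2) (x := 0) h hα0 hl le_rfl hr.le (by linarith)
  rw [norm_ray_zero hr.le] at h1 h2
  set c := Real.cos (α * θ / 2)
  have h3 : l * (r ^ (α - (α / 2 + 1)) / (c * (r ^ α + l))) ≤ l ^ (1 / α) * r ^ (α / 2 - 2) / c := by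
    have e1 : r ^ (α - (α / 2 + 1)) = r ^ (α / 2 - 2) * r := by
      rw [← Real.rpow_add_one hr.ne']; congr 1; ring
    have e2 : l = l ^ (1 / α) * l ^ (1 - 1 / α) := by
      rw [← Real.rpow_add hl, add_sub_cancel, Real.rpow_one]
    rw [← mul_div_assoc, div_le_div_iff₀ (by positivity) hc]
    calc l * r ^ (α - (α / 2 + 1)) * c
        = l ^ (1 / α) * r ^ (α / 2 - 2) * c * (r * l ^ (1 - 1 / α)) := by
          rw [e1]; nth_rewrite 1 [e2]; ring
      _ ≤ l ^ (1 / α) * r ^ (α / 2 - 2) * c * (r ^ α + l) := by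
          gcongr; exact rpow_mul_le_rpow_add hα.1 hl hr
      _ = _ := by ring
  have h4 : r ^ (α - (2 - α / 2)) / (c * (r ^ α + l)) ≤ r ^ (α / 2 - 2) / c := by
    have e1 : r ^ (α - (2 - α / 2)) = r ^ (α / 2 - 2) * r ^ α := by
      rw [← Real.rpow_add hr]; congr 1; ring
    rw [div_le_div_iff₀ (by positivity) hc, e1]
    calc r ^ (α / 2 - 2) * r ^ α * c = r ^ (α / 2 - 2) * (c * r ^ α) := by ring
      _ ≤ r ^ (α / 2 - 2) * (c * (r ^ α + l)) := by gcongr; linarith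
  refine (norm_add_le _ _).trans ?_
  rw [norm_mul, norm_mul, Complex.norm_real, Complex.norm_real, Real.norm_eq_abs, Real.norm_eq_abs,
    neg_mul, abs_neg, abs_mul, abs_of_pos hl]
  calc _ ≤ l * |a| * (r ^ (α - (α / 2 + 1)) / (c * (r ^ α + l))) +
        |b| * (r ^ (α - (2 - α / 2)) / (c * (r ^ α + l))) := by gcongr
    _ = |a| * (l * (r ^ (α - (α / 2 + 1)) / (c * (r ^ α + l)))) +
        |b| * (r ^ (α - (2 - α / 2)) / (c * (r ^ α + l))) := by ring
    _ ≤ |a| * (l ^ (1 / α) * r ^ (α / 2 - 2) / c) + |b| * (r ^ (α / 2 - 2) / c) := by gcongr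
    _ = _ := by ring

theorem hasDerivAt_mode (h : Admissible α θ) (hα : α ∈ Ioo (1 : ℝ) 2) (hl : 0 < l) (m : ℕ) {t : ℝ}
    (ht : 0 < t) : HasDerivAt (mode α θ l a b m) (mode α θ l a b (m + 1) t) t := by
  obtain ⟨K, hK, hW⟩ := exists_norm_modeSymbol_le (a := a) (b := b) h hα hl
  have h1 := hasDerivAt_laplaceRay h.cos_neg hK (by norm_num) (continuousOn_modeSymbol h hα hl) hW m ht
  have h2 := (Complex.imCLM.hasFDerivAt.comp_hasDerivAt t h1).const_mul Real.pi⁻¹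
  exact h2

/-- The constant in the bound for the derivatives of order `m ≥ 1` of a mode. -/
def modeConst (α θ : ℝ) (m : ℕ) : ℝ :=
  Real.pi⁻¹ * ((Real.cos (α * θ / 2))⁻¹ *
    ((-Real.cos θ) ^ (-(m + (α / 2 - 2) + 1)) * Real.Gamma (m + (α / 2 - 2) + 1)))

theorem modeConst_pos (h : Admissible α θ) (hα : α ∈ Ioo (1 : ℝ) 2) {m : ℕ} (hm : 1 ≤ m) :
    0 < modeConst α θ m := by
  have hm' : (1 : ℝ) ≤ m := by exact_mod_cast hm
  have h1 := h.cos_half_pos (by linarith [hα.1] : 0 < α)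
  have h2 : 0 < -Real.cos θ := by linarith [h.cos_neg]
  have h3 : 0 < Real.Gamma (m + (α / 2 - 2) + 1) := Real.Gamma_pos_of_pos (by linarith [hα.1])
  have := Real.pi_pos
  unfold modeConst
  positivity

/-- Since `α/2 - 2` lies in `(-3/2, -1)`, the majorant of the symbol is integrable at the origin
only after multiplication by `r^m` with `m ≥ 1`. -/
theorem abs_mode_le (h : Admissible α θ) (hα : α ∈ Ioo (1 : ℝ) 2) (hl : 0 < l) {m : ℕ}
    (hm : 1 ≤ m) {t : ℝ} (ht : 0 < t) : |mode α θ l a b m t| ≤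
      modeConst α θ m * (l ^ (1 / α) * |a| + |b|) * t ^ (1 - α / 2 - m) := by
  have hm' : (1 : ℝ) ≤ m := by exact_mod_cast hm
  have h1 := norm_laplaceRay_le h.cos_neg
    (fun r hr => norm_modeSymbol_le (a := a) (b := b) h hα hl hr) m (by linarith [hα.1]) ht
  have h2 := (Complex.abs_im_le_norm _).trans h1
  have hpi := Real.pi_pos
  rw [mode, abs_mul, abs_of_pos (by positivity : 0 < Real.pi⁻¹)]
  refine (mul_le_mul_of_nonneg_left h2 (by positivity)).trans (le_of_eq ?_)
  rw [modeConst, show -((m : ℝ) + (α / 2 - 2) + 1) = 1 - α / 2 - m by ring]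
  ring

theorem tendsto_mode (h : Admissible α θ) (hα : α ∈ Ioo (1 : ℝ) 2) (hl : 0 < l) {t : ℝ}
    (ht : 0 < t) : Filter.Tendsto (fun N : ℕ => ∑ k ∈ Finset.range N,
      (-l) ^ k * (-l * a * omegaKer (α * k + (α / 2 + 1)) t +
        b * omegaKer (α * k + (2 - α / 2)) t)) Filter.atTop (nhds (mode α θ l a b 0 t)) := by
  have hα0 : 0 < α := by linarith [hα.1]
  have hμ₁ : α / 2 + 1 ∈ Icc (1 / 2) (α + 1 / 2) := ⟨by linarith, by linarith [hα.1]⟩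
  have hμ₂ : 2 - α / 2 ∈ Icc (1 / 2) (α + 1 / 2) := ⟨by linarith [hα.2], by linarith [hα.1]⟩
  have h1 := tendsto_mittagLeffler h hα0 hl hμ₁ ht
  have h2 := tendsto_mittagLeffler h hα0 hl hμ₂ ht
  have hint : ∀ μ ∈ Icc (1 / 2) (α + 1 / 2), IntegrableOn (fun r => Complex.exp (θ * Complex.I) *
      (Complex.exp (t * ray θ 0 r) * (ray θ 0 r ^ 0 * symbol α l μ (ray θ 0 r)))) (Ioi 0) := by
    intro μ hμ
    refine integrableOn_laplaceRay (K := (1 + 1 / l) / Real.cos (α * θ / 2)) (p := -(1 / 2))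
      h.cos_neg ht (continuousOn_symbol_ray h hα0 hl le_rfl) (fun r hr => ?_) 0 (by norm_num)
    have := norm_symbol_le_rpow_neg_half (x := 0) h hα0 hl hμ le_rfl hr.le (by linarith)
    rwa [norm_ray_zero hr.le] at this
  have e : mode α θ l a b 0 t =
      -l * a * (Real.pi⁻¹ *
        (rayInt θ 0 fun s => Complex.exp (t * s) * symbol α l (α / 2 + 1) s).im) +
      b * (Real.pi⁻¹ *
        (rayInt θ 0 fun s => Complex.exp (t * s) * symbol α l (2 - α / 2) s).im) := by
    have e1 : laplaceRay θ (modeSymbol α l a b) 0 t =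
        ((-l * a : ℝ) : ℂ) *
          (rayInt θ 0 fun s => Complex.exp (t * s) * symbol α l (α / 2 + 1) s) +
        (b : ℂ) * (rayInt θ 0 fun s => Complex.exp (t * s) * symbol α l (2 - α / 2) s) := by
      have i₁ := hint _ hμ₁
      have i₂ := hint _ hμ₂
      simp only [pow_zero, one_mul] at i₁ i₂
      simp only [laplaceRay, rayInt, pow_zero, one_mul]
      rw [← integral_const_mul ((-l * a : ℝ) : ℂ), ← integral_const_mul (b : ℂ),
        ← integral_add (i₁.const_mul _) (i₂.const_mul _)]
      congr 1 with r
      simp only [modeSymbol]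
      ring
    rw [mode, e1, Complex.add_im, Complex.im_ofReal_mul, Complex.im_ofReal_mul]
    ring
  rw [e]
  refine ((h1.const_mul (-l * a)).add (h2.const_mul b)).congr fun N => ?_
  rw [Finset.mul_sum, Finset.mul_sum, ← Finset.sum_add_distrib]
  refine Finset.sum_congr rfl fun k _ => ?_
  ring

/-- The solution of the Volterra equation of a mode. -/
theorem eq_mode_of_volterra {T : ℝ} {V : ℝ → ℝ} (h : Admissible α θ) (hα : α ∈ Ioo (1 : ℝ) 2)
    (hl : 0 < l) (hV : ∀ t ∈ Ioo 0 T, ContinuousOn V (Icc 0 t))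
    (hVol : ∀ t ∈ Ioo 0 T, V t =
      -l * a * omegaKer (α / 2 + 1) t + b * omegaKer (2 - α / 2) t - l * fracInt α V t)
    {t : ℝ} (ht : t ∈ Ioo 0 T) : V t = mode α θ l a b 0 t := by
  have h1 := (tendsto_mode (a := a) (b := b) h hα hl ht.1).comp (Filter.tendsto_add_atTop_nat 1)
  have h2 := tendsto_volterra_remainder (l := l) hα.1.le ht.1 (hV t ht)
  have h3 := h1.add h2
  rw [add_zero] at h3
  refine tendsto_nhds_unique (tendsto_const_nhds.congr fun N => ?_) h3
  exact volterra_iterate hα.1.le (by linarith [hα.1]) (by linarith [hα.2]) hV hVol ht N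

/-- A bound for a function that vanishes at `0` from a bound for its derivative. -/
theorem abs_le_of_abs_deriv_le {V V' : ℝ → ℝ} {M q t : ℝ} (hq : 0 < q) (ht : 0 < t)
    (hV : ContinuousOn V (Icc 0 t)) (hV0 : V 0 = 0)
    (hd : ∀ s ∈ Ioo 0 t, HasDerivAt V (V' s) s) (hb : ∀ s ∈ Ioo 0 t, |V' s| ≤ M * s ^ (q - 1)) :
    |V t| ≤ M / q * t ^ q := by
  have hp : ∀ s ∈ Ioo 0 t, HasDerivAt (fun s : ℝ => M / q * s ^ q) (M * s ^ (q - 1)) s := by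
    intro s hs
    refine ((Real.hasDerivAt_rpow_const (Or.inl hs.1.ne')).const_mul (M / q)).congr_deriv ?_
    field_simp
  have hpc : ContinuousOn (fun s : ℝ => M / q * s ^ q) (Icc 0 t) :=
    (continuous_const.mul (Real.continuous_rpow_const hq.le)).continuousOn
  -- With `σ = ±1` this treats both signs of `V` at once; only continuity is needed at the endpoint
  -- `0`.
  have hmono : ∀ σ : ℝ, |σ| = 1 → MonotoneOn (fun s => M / q * s ^ q - σ * V s) (Icc 0 t) := by
    intro σ hσ
    refine monotoneOn_of_deriv_nonneg (convex_Icc 0 t) (hpc.sub (continuousOn_const.mul hV)) ?_ ?_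
    · rw [interior_Icc]
      exact fun s hs => ((hp s hs).fun_sub ((hd s hs).const_mul σ)).differentiableAt.differentiableWithinAt
    · rw [interior_Icc]
      intro s hs
      rw [((hp s hs).fun_sub ((hd s hs).const_mul σ)).deriv]
      have h1 : σ * V' s ≤ |V' s| := by
        have := le_abs_self (σ * V' s)
        rwa [abs_mul, hσ, one_mul] at this
      linarith [hb s hs]
  have h0 : (0 : ℝ) ∈ Icc 0 t := ⟨le_rfl, ht.le⟩
  have h1 : t ∈ Icc 0 t := ⟨ht.le, le_rfl⟩
  have hp1 := hmono 1 (by simp) h0 h1 ht.le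
  have hm1 := hmono (-1) (by simp) h0 h1 ht.le
  simp only [hV0, Real.zero_rpow hq.ne'] at hp1 hm1
  rw [abs_le]
  constructor <;> linarith

end mode

/-! ### Orthogonal series and termwise differentiation -/

section orthonormal

variable {H : Type*} [NormedAddCommGroup H] [InnerProductSpace ℝ H] [CompleteSpace H] {e : ℕ → H}

theorem _root_.Orthonormal.summable_smul (he : Orthonormal ℝ e) {c : ℕ → ℝ}
    (hc : Summable fun n => |c n| ^ 2) : Summable fun n => c n • e n :=
  (he.orthogonalFamily.summable_iff_norm_sq_summable c).2 hc

theorem _root_.Orthonormal.norm_tsum_smul_sq (he : Orthonormal ℝ e) {c : ℕ → ℝ}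
    (hc : Summable fun n => |c n| ^ 2) : ‖∑' n, c n • e n‖ ^ 2 = ∑' n, |c n| ^ 2 := by
  have h1 := ((continuous_norm.pow 2).tendsto _).comp (he.summable_smul hc).hasSum
  refine tendsto_nhds_unique h1 (hc.hasSum.congr fun s => ?_)
  exact (he.orthogonalFamily.norm_sum c s).symm

theorem summable_sq_of_abs_le {c A : ℕ → ℝ} {g : ℝ} (hA : Summable fun n => A n ^ 2)
    (h : ∀ n, |c n| ≤ A n * g) : Summable fun n => |c n| ^ 2 := by
  refine Summable.of_nonneg_of_le (fun n => by positivity) (fun n => ?_) (hA.mul_right (g ^ 2))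
  rw [← mul_pow]
  exact pow_le_pow_left₀ (abs_nonneg _) (h n) 2

theorem _root_.Orthonormal.norm_tsum_smul_sq_le (he : Orthonormal ℝ e) {c A : ℕ → ℝ} {g : ℝ}
    (hA : Summable fun n => A n ^ 2) (h : ∀ n, |c n| ≤ A n * g) :
    ‖∑' n, c n • e n‖ ^ 2 ≤ (∑' n, A n ^ 2) * g ^ 2 := by
  have hc := summable_sq_of_abs_le hA h
  rw [he.norm_tsum_smul_sq hc, ← tsum_mul_right]
  refine hc.tsum_le_tsum (fun n => ?_) (hA.mul_right _)
  rw [← mul_pow]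
  exact pow_le_pow_left₀ (abs_nonneg _) (h n) 2

/-- Termwise differentiation of an orthogonal series with square-summable majorants. -/
theorem _root_.Orthonormal.hasDerivAt_tsum_smul (he : Orthonormal ℝ e) {c c' : ℕ → ℝ → ℝ}
    {A : ℕ → ℝ} {g g' : ℝ → ℝ} {s : Set ℝ} (hs : IsOpen s) (hA : Summable fun n => A n ^ 2)
    (hA0 : ∀ n, 0 ≤ A n)
    (hc : ∀ n, ∀ t ∈ s, HasDerivAt (c n) (c' n t) t) (hg : ∀ n, ∀ t ∈ s, |c n t| ≤ A n * g t)
    (hg' : ∀ n, ∀ t ∈ s, |c' n t| ≤ A n * g' t) (hgc : ContinuousOn g' s) {t : ℝ} (ht : t ∈ s) :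
    HasDerivAt (fun t => ∑' n, c n t • e n) (∑' n, c' n t • e n) t := by
  -- By continuity `g' < B` near `t`. There the squared tails of the differentiated series are at
  -- most `B^2` times tails of `∑ A n ^ 2`, so convergence is locally uniform.
  set B : ℝ := g' t + 1 with hB
  obtain ⟨u, hus, hu, htu⟩ : ∃ u ⊆ s ∩ g' ⁻¹' Iio B, IsOpen u ∧ t ∈ u :=
    mem_nhds_iff.1 (Filter.inter_mem (hs.mem_nhds ht)
      ((hgc.continuousAt (hs.mem_nhds ht)).preimage_mem_nhds (Iio_mem_nhds (by linarith))))
  have hB' : ∀ n, ∀ x ∈ u, |c' n x| ≤ A n * B := fun n x hx =>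
    (hg' n x (hus hx).1).trans (mul_le_mul_of_nonneg_left (le_of_lt (hus hx).2) (hA0 n))
  refine hasDerivAt_of_tendstoUniformlyOn (l := Filter.atTop) (s := u)
    (f := fun N : ℕ => fun t => ∑ n ∈ Finset.range N, c n t • e n)
    (f' := fun N : ℕ => fun t => ∑ n ∈ Finset.range N, c' n t • e n)
    (g := fun t => ∑' n, c n t • e n) (g' := fun t => ∑' n, c' n t • e n) hu ?_ ?_ ?_ htu
  · have htail : Filter.Tendsto (fun N : ℕ => (∑' k, A (k + N) ^ 2) * B ^ 2) Filter.atTop (nhds 0) := by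
      simpa using (tendsto_sum_nat_add fun n => A n ^ 2).mul_const (B ^ 2)
    rw [Metric.tendstoUniformlyOn_iff]
    intro ε hε
    filter_upwards [htail.eventually_lt_const (show 0 < ε ^ 2 by positivity)] with N hN x hx
    have hsum := he.summable_smul (summable_sq_of_abs_le hA fun n => hB' n x hx)
    have hshift : Orthonormal ℝ fun k => e (k + N) := he.comp (· + N) (add_left_injective N)
    have h1 := hshift.norm_tsum_smul_sq_le (c := fun k => c' (k + N) x)
      ((summable_nat_add_iff (f := fun n => A n ^ 2) N).2 hA) (fun k => hB' (k + N) x hx)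
    rw [dist_eq_norm, ← hsum.sum_add_tsum_nat_add N, add_sub_cancel_left]
    exact lt_of_pow_lt_pow_left₀ 2 hε.le (h1.trans_lt hN)
  · refine Filter.Eventually.of_forall fun N x hx => ?_
    exact HasDerivAt.fun_sum fun n _ => (hc n x (hus hx).1).smul_const (e n)
  · intro x hx
    exact (he.summable_smul (summable_sq_of_abs_le hA fun n =>
      hg n x (hus hx).1)).hasSum.tendsto_sum_nat

end orthonormal

theorem iteratedDeriv_eqOn_of_hasDerivAt {E : Type*} [NormedAddCommGroup E] [NormedSpace ℝ E]
    {s : Set ℝ} (hs : IsOpen s) {f : ℕ → ℝ → E} {g : ℝ → E} (hg : EqOn g (f 0) s)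
    (hf : ∀ m, ∀ t ∈ s, HasDerivAt (f m) (f (m + 1) t) t) (m : ℕ) :
    EqOn (iteratedDeriv m g) (f m) s := by
  induction m with
  | zero => simpa using hg
  | succ m ih =>
    intro t ht
    rw [iteratedDeriv_succ, (Filter.eventuallyEq_of_mem (hs.mem_nhds ht) ih).deriv_eq,
      (hf m t ht).deriv]

theorem contDiffOn_of_hasDerivAt {E : Type*} [NormedAddCommGroup E] [NormedSpace ℝ E]
    {s : Set ℝ} (hs : IsOpen s) {f : ℕ → ℝ → E} {g : ℝ → E} (hg : EqOn g (f 0) s)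
    (hf : ∀ m, ∀ t ∈ s, HasDerivAt (f m) (f (m + 1) t) t) : ContDiffOn ℝ ∞ g s := by
  refine contDiffOn_of_differentiableOn_deriv fun m _ t ht => ?_
  have h1 : EqOn (iteratedDerivWithin m g s) (f m) s := fun x hx =>
    (iteratedDerivWithin_of_isOpen hs hx).trans (iteratedDeriv_eqOn_of_hasDerivAt hs hg hf m hx)
  exact ((hf m t ht).differentiableAt.differentiableWithinAt).congr h1 (h1 ht)

/-! ### Dirichlet eigenfunctions and Parseval's identity -/

section eigen

variable {L : ℝ}

theorem contDiff_eigenfun (L : ℝ) (n : ℕ) : ContDiff ℝ ∞ (eigenfun L n) := by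
  unfold eigenfun; fun_prop

theorem eigenfun_zero (L : ℝ) (n : ℕ) : eigenfun L n 0 = 0 := by simp [eigenfun]

theorem eigenfun_right (hL : L ≠ 0) (n : ℕ) : eigenfun L n L = 0 := by
  have h : ((n : ℝ) + 1) * Real.pi / L * L = ((n + 1 : ℕ) : ℝ) * Real.pi := by
    push_cast; field_simp
  rw [eigenfun, h, Real.sin_nat_mul_pi, mul_zero]

theorem deriv_deriv_eigenfun (L : ℝ) (n : ℕ) :
    deriv (deriv (eigenfun L n)) = fun x => -eigenval L n * eigenfun L n x := by
  have hlin : ∀ x, HasDerivAt (fun x : ℝ => ((n : ℝ) + 1) * Real.pi / L * x)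
      (((n : ℝ) + 1) * Real.pi / L) x := fun x => by
    simpa using (hasDerivAt_id x).const_mul (((n : ℝ) + 1) * Real.pi / L)
  have h1 : deriv (eigenfun L n) = fun x => Real.sqrt (2 / L) *
      (Real.cos (((n : ℝ) + 1) * Real.pi / L * x) * (((n : ℝ) + 1) * Real.pi / L)) := by
    ext x
    exact ((hlin x).sin.const_mul _).deriv
  ext x
  rw [h1, (((hlin x).cos.mul_const (((n : ℝ) + 1) * Real.pi / L)).const_mul
    (Real.sqrt (2 / L))).deriv, eigenval, eigenfun]
  ring

theorem eigenval_pos (hL : 0 < L) (n : ℕ) : 0 < eigenval L n := by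
  have := Real.pi_pos
  unfold eigenval; positivity

theorem eigenval_zero_le (hL : 0 < L) (n : ℕ) : eigenval L 0 ≤ eigenval L n := by
  have := Real.pi_pos
  unfold eigenval
  gcongr
  simp

theorem integral_cos_int_mul (hL : 0 < L) (k : ℤ) :
    ∫ x in (0 : ℝ)..L, Real.cos (k * (Real.pi / L) * x) = if k = 0 then L else 0 := by
  split_ifs with h
  · simp [h]
  · have hk : (k : ℝ) * (Real.pi / L) ≠ 0 :=
      mul_ne_zero (by exact_mod_cast h) (by have := Real.pi_pos; positivity)
    rw [intervalIntegral.integral_comp_mul_left (fun x => Real.cos x) hk, integral_cos,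
      mul_zero, Real.sin_zero, sub_zero, show (k : ℝ) * (Real.pi / L) * L = k * Real.pi by
        field_simp, Real.sin_int_mul_pi, smul_zero]

theorem integral_eigenfun_mul_eigenfun (hL : 0 < L) (m n : ℕ) :
    ∫ x in Ioo 0 L, eigenfun L m x * eigenfun L n x = if m = n then 1 else 0 := by
  rw [← integral_Ioc_eq_integral_Ioo, ← intervalIntegral.integral_of_le hL.le]
  -- Product-to-sum formula. As indices start at `0`, the frequencies are `m - n` and `m + n + 2`,
  -- and the second never vanishes.
  have h : ∀ x, eigenfun L m x * eigenfun L n x = L⁻¹ *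
      (Real.cos (((m : ℤ) - n : ℤ) * (Real.pi / L) * x) -
        Real.cos (((m : ℤ) + n + 2 : ℤ) * (Real.pi / L) * x)) := by
    intro x
    have hsq : Real.sqrt (2 / L) * Real.sqrt (2 / L) = 2 / L :=
      Real.mul_self_sqrt (by positivity)
    have e1 : ((((m : ℤ) - n : ℤ) : ℝ)) * (Real.pi / L) * x =
        ((m : ℝ) + 1) * Real.pi / L * x - ((n : ℝ) + 1) * Real.pi / L * x := by push_cast; ring
    have e2 : ((((m : ℤ) + n + 2 : ℤ) : ℝ)) * (Real.pi / L) * x =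
        ((m : ℝ) + 1) * Real.pi / L * x + ((n : ℝ) + 1) * Real.pi / L * x := by push_cast; ring
    rw [e1, e2, Real.cos_sub, Real.cos_add, eigenfun, eigenfun]
    linear_combination (Real.sin (((m : ℝ) + 1) * Real.pi / L * x) *
      Real.sin (((n : ℝ) + 1) * Real.pi / L * x)) * hsq
  simp_rw [h]
  rw [intervalIntegral.integral_const_mul, intervalIntegral.integral_sub
    (Continuous.intervalIntegrable (by fun_prop) _ _)
    (Continuous.intervalIntegrable (by fun_prop) _ _), integral_cos_int_mul hL,
    integral_cos_int_mul hL, if_neg (by omega : ¬((m : ℤ) + n + 2 = 0))]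
  by_cases hmn : m = n
  · simp [hmn, hL.ne']
  · rw [if_neg (by omega), if_neg hmn]; simp

theorem orthonormal_eigenvec (hL : 0 < L) : Orthonormal ℝ (eigenvec L) := by
  rw [orthonormal_iff_ite]
  intro m n
  rw [L2.inner_def, ← integral_eigenfun_mul_eigenfun hL m n]
  refine integral_congr_ae ?_
  filter_upwards [(memLp_eigenfun L m).coeFn_toLp, (memLp_eigenfun L n).coeFn_toLp] with x h1 h2
  simp only [eigenvec, h1, h2, RCLike.inner_apply, conj_trivial]
  ring

theorem norm_fracLaplacian_sq (hL : 0 < L) {s : ℝ} {w : L2 L} (hw : w ∈ fracDomain L s) :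
    ‖fracLaplacian L s w‖ ^ 2 = ∑' n, |eigenval L n ^ s * pair w (eigenfun L n)| ^ 2 :=
  (orthonormal_eigenvec hL).norm_tsum_smul_sq hw

theorem pair_deriv_deriv_eigenfun (w : L2 L) (n : ℕ) :
    pair w (deriv (deriv (eigenfun L n))) = -eigenval L n * pair w (eigenfun L n) := by
  rw [deriv_deriv_eigenfun, pair, pair, ← integral_const_mul]
  congr 1 with x
  ring

end eigen

theorem pair_zero {L : ℝ} (ψ : ℝ → ℝ) : pair (0 : L2 L) ψ = 0 := by
  rw [pair, integral_congr_ae (g := fun _ => (0 : ℝ)), integral_zero]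
  filter_upwards [Lp.coeFn_zero ℝ 2 (volume.restrict (Ioo (0 : ℝ) L))] with x hx
  rw [hx]; simp

/-! ### Modes of a solution -/

section solution

variable {α θ L T : ℝ} {a₀ a₁ f : L2 L} {u v : ℝ → L2 L}

/-- An eigenfunction is an admissible test function, and testing with it gives a closed scalar
system. Both sources have the same time profile because `t^(1-α) = Γ(2-α) ω_{2-α}(t)`. -/
theorem IsSolution.pair_v_eq_mode (h : Admissible α θ) (hα : α ∈ Ioo (1 : ℝ) 2) (hL : 0 < L)
    (hs : IsSolution α L T a₀ a₁ f u v) (n : ℕ) {t : ℝ} (ht : t ∈ Ioo 0 T) :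
    pair (v t) (eigenfun L n) = mode α θ (eigenval L n) (pair a₀ (eigenfun L n))
      (pair a₁ (eigenfun L n) + Real.Gamma (2 - α) * pair f (eigenfun L n)) 0 t := by
  have h1 := contDiff_eigenfun L n
  have h2 := eigenfun_zero L n
  have h3 := eigenfun_right hL.ne' n
  have hV := hs.ac_v _ h1 h2 h3
  have hV0 : pair (v 0) (eigenfun L n) = 0 := by rw [hs.init_v, pair_zero]
  have hU0 : pair (u 0) (eigenfun L n) = pair a₀ (eigenfun L n) := by rw [hs.init_u]
  have heq : ∀ᵐ t ∂volume.restrict (Ioo (0 : ℝ) T),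
      caputo (α / 2) (fun t => pair (v t) (eigenfun L n)) t =
        -eigenval L n * pair (u t) (eigenfun L n) +
        (pair a₁ (eigenfun L n) + Real.Gamma (2 - α) * pair f (eigenfun L n)) *
          omegaKer (2 - 2 * (α / 2)) t := by
    filter_upwards [hs.eq_v _ h1 h2 h3] with t ht
    rw [pair_deriv_deriv_eigenfun] at ht
    have hΓ : Real.Gamma (2 - α) ≠ 0 := (Real.Gamma_pos_of_pos (by linarith [hα.2])).ne'
    have e : t ^ (1 - α) = Real.Gamma (2 - α) * omegaKer (2 - α) t := by
      rw [omegaKer, show 2 - α - 1 = 1 - α by ring]; field_simp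
    rw [e] at ht
    rw [show 2 - 2 * (α / 2) = 2 - α by ring]
    linear_combination ht
  refine eq_mode_of_volterra h hα (eigenval_pos hL n)
    (V := fun t => pair (v t) (eigenfun L n)) (fun t ht => hV.continuousOn ht) (fun t ht => ?_) ht
  have := volterra_of_caputo (β := α / 2) ⟨by linarith [hα.1], by linarith [hα.2]⟩
    (hs.ac_u _ h1 h2 h3) hV hV0 (hs.eq_u _ h1 h2 h3) heq ht
  rwa [hU0, show 2 * (α / 2) = α by ring] at this

end solution

/-- The constant in the bound for the derivatives of order `m` of a mode. -/
def modeBound (α θ : ℝ) (m : ℕ) : ℝ :=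
  if m = 0 then modeConst α θ 1 / (1 - α / 2) else modeConst α θ m

theorem modeBound_pos {α θ : ℝ} (h : Admissible α θ) (hα : α ∈ Ioo (1 : ℝ) 2) (m : ℕ) :
    0 < modeBound α θ m := by
  unfold modeBound
  split_ifs with hm
  · exact div_pos (modeConst_pos h hα le_rfl) (by linarith [hα.2])
  · exact modeConst_pos h hα (Nat.one_le_iff_ne_zero.2 hm)

/-- For `m ≥ 1` this is the contour estimate. For `m = 0` the first-derivative bound `s^(-α/2)` is
integrated from `0`, which yields the factor `1 / (1 - α/2)`; continuity at `0` and the zero initial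
value come from the solution. -/
theorem IsSolution.abs_mode_le {α θ L T : ℝ} {a₀ a₁ f : L2 L} {u v : ℝ → L2 L}
    (h : Admissible α θ) (hα : α ∈ Ioo (1 : ℝ) 2) (hL : 0 < L)
    (hs : IsSolution α L T a₀ a₁ f u v) (n m : ℕ) {t : ℝ} (ht : t ∈ Ioo 0 T) :
    |mode α θ (eigenval L n) (pair a₀ (eigenfun L n))
      (pair a₁ (eigenfun L n) + Real.Gamma (2 - α) * pair f (eigenfun L n)) m t| ≤
      (eigenval L n ^ (1 / α) * |pair a₀ (eigenfun L n)| +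
        |pair a₁ (eigenfun L n) + Real.Gamma (2 - α) * pair f (eigenfun L n)|) *
      (modeBound α θ m * t ^ (1 - α / 2 - m)) := by
  have hl := eigenval_pos hL n
  set a := pair a₀ (eigenfun L n)
  set b := pair a₁ (eigenfun L n) + Real.Gamma (2 - α) * pair f (eigenfun L n)
  rcases Nat.eq_zero_or_pos m with rfl | hm
  · rw [← hs.pair_v_eq_mode h hα hL n ht]
    have hV := (hs.ac_v _ (contDiff_eigenfun L n) (eigenfun_zero L n)
      (eigenfun_right hL.ne' n)).continuousOn ht
    have key := abs_le_of_abs_deriv_le (V := fun t => pair (v t) (eigenfun L n))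
      (V' := fun t => mode α θ (eigenval L n) a b 1 t)
      (M := modeConst α θ 1 * (eigenval L n ^ (1 / α) * |a| + |b|)) (q := 1 - α / 2)
      (by linarith [hα.2]) ht.1 hV (by simp only [hs.init_v, pair_zero]) ?_ ?_
    · refine key.trans (le_of_eq ?_)
      simp only [modeBound, if_true, Nat.cast_zero, sub_zero]
      ring
    · intro s hst
      refine (hasDerivAt_mode h hα hl 0 hst.1).congr_of_eventuallyEq ?_
      filter_upwards [isOpen_Ioo.mem_nhds hst] with x hx
      exact hs.pair_v_eq_mode h hα hL n ⟨hx.1, hx.2.trans ht.2⟩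
    · intro s hst
      have := DiffusionWave.abs_mode_le (a := a) (b := b) h hα hl le_rfl hst.1
      simpa using this
  · refine (DiffusionWave.abs_mode_le h hα hl hm ht.1).trans (le_of_eq ?_)
    rw [modeBound, if_neg hm.ne']
    ring

/-! ### Square-summable majorant in terms of the data -/

/-- The majorant of the modes of `(-Δ)^(1/2) v`. -/
def majorant {L : ℝ} (α : ℝ) (a₀ a₁ f : L2 L) (n : ℕ) : ℝ :=
  eigenval L n ^ (1 / 2 : ℝ) * (eigenval L n ^ (1 / α) * |pair a₀ (eigenfun L n)| +
    |pair a₁ (eigenfun L n) + Real.Gamma (2 - α) * pair f (eigenfun L n)|)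

theorem majorant_nonneg {α L : ℝ} (hL : 0 < L) (a₀ a₁ f : L2 L) (n : ℕ) :
    0 ≤ majorant α a₀ a₁ f n := by
  have := eigenval_pos hL n
  unfold majorant; positivity

/-- The exponent `1/α + 1/2 - γ` is negative, so its power of any eigenvalue is at most that of the
smallest one, which is the constant `D`. -/
theorem exists_majorant_le {α γ L : ℝ} (hα : α ∈ Ioo (1 : ℝ) 2) (hγ : 1 / α + 1 / 2 < γ)
    (hL : 0 < L) : ∃ E : ℝ, 0 < E ∧ ∀ a₀ a₁ f : L2 L, ∀ n, majorant α a₀ a₁ f n ≤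
      E * (|eigenval L n ^ γ * pair a₀ (eigenfun L n)| +
        |eigenval L n ^ (1 / 2 : ℝ) * pair a₁ (eigenfun L n)| +
        |eigenval L n ^ (1 / 2 : ℝ) * pair f (eigenfun L n)|) := by
  have hG : 0 < Real.Gamma (2 - α) := Real.Gamma_pos_of_pos (by linarith [hα.2])
  have hl0 := eigenval_pos hL 0
  set D : ℝ := eigenval L 0 ^ (1 / α + 1 / 2 - γ)
  have hD : 0 < D := Real.rpow_pos_of_pos hl0 _
  refine ⟨D + 1 + Real.Gamma (2 - α), by positivity, fun a₀ a₁ f n => ?_⟩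
  have hl := eigenval_pos hL n
  have h1 : eigenval L n ^ (1 / 2 : ℝ) * eigenval L n ^ (1 / α) ≤ D * eigenval L n ^ γ := by
    have e : eigenval L n ^ (1 / 2 : ℝ) * eigenval L n ^ (1 / α) =
        eigenval L n ^ (1 / α + 1 / 2 - γ) * eigenval L n ^ γ := by
      rw [← Real.rpow_add hl, ← Real.rpow_add hl]; congr 1; ring
    rw [e]
    refine mul_le_mul_of_nonneg_right ?_ (by positivity)
    exact Real.rpow_le_rpow_of_nonpos hl0 (eigenval_zero_le hL n) (by linarith)
  rw [abs_mul, abs_mul, abs_mul, abs_of_pos (Real.rpow_pos_of_pos hl γ),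
    abs_of_pos (Real.rpow_pos_of_pos hl (1 / 2)), majorant]
  have h2 := abs_add_le (pair a₁ (eigenfun L n)) (Real.Gamma (2 - α) * pair f (eigenfun L n))
  rw [abs_mul, abs_of_pos hG] at h2
  set x := |pair a₀ (eigenfun L n)|
  set y := |pair a₁ (eigenfun L n)|
  set z := |pair f (eigenfun L n)|
  have hx : 0 ≤ x := abs_nonneg _
  have hy : 0 ≤ y := abs_nonneg _
  have hz : 0 ≤ z := abs_nonneg _
  set p := eigenval L n ^ (1 / 2 : ℝ)
  set q := eigenval L n ^ γ
  have hp : 0 < p := Real.rpow_pos_of_pos hl _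
  have hq : 0 < q := Real.rpow_pos_of_pos hl _
  set G := Real.Gamma (2 - α)
  calc _ ≤ p * (eigenval L n ^ (1 / α) * x + (y + G * z)) := by gcongr
    _ = p * eigenval L n ^ (1 / α) * x + p * y + G * (p * z) := by ring
    _ ≤ D * q * x + p * y + G * (p * z) := by gcongr
    _ ≤ D * q * x + p * y + G * (p * z) +
        ((1 + G) * (q * x) + (D + G) * (p * y) + (D + 1) * (p * z)) :=
      le_add_of_nonneg_right (by positivity)
    _ = _ := by ring

theorem summable_tsum_majorant_sq {p q r A : ℕ → ℝ} {E P Q R : ℝ}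
    (hA0 : ∀ n, 0 ≤ A n) (hA : ∀ n, A n ≤ E * (|p n| + |q n| + |r n|))
    (hP : HasSum (fun n => |p n| ^ 2) (P ^ 2)) (hQ : HasSum (fun n => |q n| ^ 2) (Q ^ 2))
    (hR : HasSum (fun n => |r n| ^ 2) (R ^ 2)) (hP0 : 0 ≤ P) (hQ0 : 0 ≤ Q) (hR0 : 0 ≤ R) :
    Summable (fun n => A n ^ 2) ∧ ∑' n, A n ^ 2 ≤ (2 * E * (P + Q + R)) ^ 2 := by
  have h1 : ∀ n, A n ^ 2 ≤ 3 * E ^ 2 * (|p n| ^ 2 + |q n| ^ 2 + |r n| ^ 2) := by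
    intro n
    have h2 : (|p n| + |q n| + |r n|) ^ 2 ≤ 3 * (|p n| ^ 2 + |q n| ^ 2 + |r n| ^ 2) := by
      nlinarith [sq_nonneg (|p n| - |q n|), sq_nonneg (|p n| - |r n|), sq_nonneg (|q n| - |r n|)]
    calc A n ^ 2 ≤ (E * (|p n| + |q n| + |r n|)) ^ 2 := pow_le_pow_left₀ (hA0 n) (hA n) 2
      _ = E ^ 2 * (|p n| + |q n| + |r n|) ^ 2 := by ring
      _ ≤ E ^ 2 * (3 * (|p n| ^ 2 + |q n| ^ 2 + |r n| ^ 2)) := by gcongr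
      _ = _ := by ring
  have h3 := ((hP.add hQ).add hR).mul_left (3 * E ^ 2)
  have h4 : Summable fun n => A n ^ 2 :=
    Summable.of_nonneg_of_le (fun n => sq_nonneg _) h1 h3.summable
  refine ⟨h4, (h4.tsum_le_tsum h1 h3.summable).trans ?_⟩
  rw [h3.tsum_eq]
  have h5 : 0 ≤ E ^ 2 * (P ^ 2 + Q ^ 2 + R ^ 2) := by positivity
  have h6 : 0 ≤ E ^ 2 * (P * Q + Q * R + P * R) := by positivity
  -- The factor `2` replaces the sharper `√3` to avoid a root: `3 (P² + Q² + R²) ≤ 4 (P + Q + R)²`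
  -- for nonnegative numbers.
  linarith [show (2 * E * (P + Q + R)) ^ 2 - 3 * E ^ 2 * (P ^ 2 + Q ^ 2 + R ^ 2) =
    E ^ 2 * (P ^ 2 + Q ^ 2 + R ^ 2) + 8 * (E ^ 2 * (P * Q + Q * R + P * R)) by ring]

theorem hasSum_norm_fracLaplacian {L s : ℝ} (hL : 0 < L) {w : L2 L} (hw : w ∈ fracDomain L s) :
    HasSum (fun n => |eigenval L n ^ s * pair w (eigenfun L n)| ^ 2) (‖fracLaplacian L s w‖ ^ 2) := by
  rw [norm_fracLaplacian_sq hL hw]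
  exact Summable.hasSum hw

end DiffusionWave

end

open DiffusionWave

/-! ### Summation over the modes -/

theorem lemma3p6 (α γ L : ℝ) (hα : α ∈ Set.Ioo (1 : ℝ) 2)
    (hγ : γ ∈ Set.Ioc (1 / α + 1 / 2) (3 / 2)) (hL : 0 < L) :
    ∃ C : ℝ, 0 < C ∧ ∀ T : ℝ, 0 < T →
      ∀ a₀ ∈ DiffusionWave.fracDomain L γ,
      ∀ a₁ ∈ DiffusionWave.fracDomain L (1 / 2),
      ∀ f ∈ DiffusionWave.fracDomain L (1 / 2),
      ∀ u v : ℝ → DiffusionWave.L2 L, DiffusionWave.IsSolution α L T a₀ a₁ f u v →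
        (∀ t ∈ Set.Ioo (0 : ℝ) T, v t ∈ DiffusionWave.fracDomain L (1 / 2)) ∧
        ContDiffOn ℝ 3 (fun t => DiffusionWave.fracLaplacian L (1 / 2) (v t)) (Set.Ioo 0 T) ∧
        ∀ m : ℕ, m ≤ 3 → ∀ t ∈ Set.Ioo (0 : ℝ) T,
          ‖iteratedDeriv m (fun s => DiffusionWave.fracLaplacian L (1 / 2) (v s)) t‖ ≤
            C * t ^ (1 - α / 2 - (m : ℝ)) *
              (‖DiffusionWave.fracLaplacian L γ a₀‖ + ‖DiffusionWave.fracLaplacian L (1 / 2) a₁‖ +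
                ‖DiffusionWave.fracLaplacian L (1 / 2) f‖) := by
  obtain ⟨θ, hθ⟩ := exists_admissible hα
  obtain ⟨E, hE, hmaj⟩ := exists_majorant_le hα hγ.1 hL
  have hB := modeBound_pos hθ hα
  have hBle : ∀ m ≤ 3, modeBound α θ m ≤ ∑ k ∈ Finset.range 4, modeBound α θ k := fun m hm =>
    Finset.single_le_sum (f := modeBound α θ) (fun k _ => (hB k).le)
      (Finset.mem_range.2 (by omega))
  -- The sum of the four mode constants serves all orders `m ≤ 3` at once.
  refine ⟨2 * E * ∑ k ∈ Finset.range 4, modeBound α θ k,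
    mul_pos (by positivity) ((hB 0).trans_le (hBle 0 (by norm_num))), ?_⟩
  intro T _ a₀ ha₀ a₁ ha₁ f hf u v hs
  set A : ℕ → ℝ := majorant α a₀ a₁ f with hAdef
  have hA0 : ∀ n, 0 ≤ A n := majorant_nonneg hL a₀ a₁ f
  set S : ℝ := ‖fracLaplacian L γ a₀‖ + ‖fracLaplacian L (1 / 2) a₁‖ +
    ‖fracLaplacian L (1 / 2) f‖ with hS
  have hS0 : 0 ≤ S := by positivity
  obtain ⟨hAs, hAle⟩ := summable_tsum_majorant_sq hA0 (hmaj a₀ a₁ f)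
    (hasSum_norm_fracLaplacian hL ha₀) (hasSum_norm_fracLaplacian hL ha₁)
    (hasSum_norm_fracLaplacian hL hf) (norm_nonneg _) (norm_nonneg _) (norm_nonneg _)
  rw [← hS] at hAle
  set w : ℕ → ℕ → ℝ → ℝ := fun m n t => eigenval L n ^ (1 / 2 : ℝ) *
    mode α θ (eigenval L n) (pair a₀ (eigenfun L n))
      (pair a₁ (eigenfun L n) + Real.Gamma (2 - α) * pair f (eigenfun L n)) m t with hw
  have hwv : ∀ n, ∀ t ∈ Ioo 0 T,
      eigenval L n ^ (1 / 2 : ℝ) * pair (v t) (eigenfun L n) = w 0 n t := fun n t ht => by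
    rw [hs.pair_v_eq_mode hθ hα hL n ht]
  have hwle : ∀ m n, ∀ t ∈ Ioo 0 T,
      |w m n t| ≤ A n * (modeBound α θ m * t ^ (1 - α / 2 - (m : ℝ))) := by
    intro m n t ht
    have hp := Real.rpow_pos_of_pos (eigenval_pos hL n) (1 / 2)
    simp only [hw, hAdef, majorant]
    rw [abs_mul, abs_of_pos hp, mul_assoc]
    exact mul_le_mul_of_nonneg_left (hs.abs_mode_le hθ hα hL n m ht) hp.le
  have he := orthonormal_eigenvec hL
  -- `F m` is the series differentiated `m` times term by term; each `F (m + 1)` is the derivative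
  -- of `F m`, so `F 0` is smooth on `(0, T)`.
  set F : ℕ → ℝ → L2 L := fun m t => ∑' n, w m n t • eigenvec L n with hF
  have hFd : ∀ m, ∀ t ∈ Ioo 0 T, HasDerivAt (F m) (F (m + 1) t) t := by
    intro m t ht
    refine he.hasDerivAt_tsum_smul isOpen_Ioo hAs hA0 ?_ (hwle m) (hwle (m + 1)) ?_ ht
    · exact fun n t ht => (hasDerivAt_mode hθ hα (eigenval_pos hL n) m ht.1).const_mul _
    · exact fun t ht => (continuousAt_const.mul
        (Real.continuousAt_rpow_const _ _ (Or.inl ht.1.ne'))).continuousWithinAt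
  have hF0 : EqOn (fun t => fracLaplacian L (1 / 2) (v t)) (F 0) (Ioo 0 T) := by
    intro t ht
    simp only [fracLaplacian, hF, hwv _ t ht]
  refine ⟨fun t ht => ?_, (contDiffOn_of_hasDerivAt isOpen_Ioo hF0 hFd).of_le
    (WithTop.coe_le_coe.2 (le_top : (3 : ℕ∞) ≤ ⊤)), fun m hm t ht => ?_⟩
  · simp only [fracDomain, mem_ofPred_eq, hwv _ t ht]
    exact summable_sq_of_abs_le hAs fun n => hwle 0 n t ht
  · rw [iteratedDeriv_eqOn_of_hasDerivAt isOpen_Ioo hF0 hFd m ht]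
    have htp : 0 < t ^ (1 - α / 2 - (m : ℝ)) := Real.rpow_pos_of_pos ht.1 _
    have h1 := he.norm_tsum_smul_sq_le hAs fun n => hwle m n t ht
    have h2 : ‖F m t‖ ^ 2 ≤
        (2 * E * S * (modeBound α θ m * t ^ (1 - α / 2 - (m : ℝ)))) ^ 2 := by
      refine h1.trans ?_
      rw [mul_pow _ (modeBound α θ m * _)]
      gcongr
    have h3 := le_of_sq_le_sq h2 (by have := hB m; positivity)
    calc ‖F m t‖ ≤ 2 * E * S * (modeBound α θ m * t ^ (1 - α / 2 - (m : ℝ))) := h3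
      _ ≤ 2 * E * S * ((∑ k ∈ Finset.range 4, modeBound α θ k) *
          t ^ (1 - α / 2 - (m : ℝ))) := by gcongr; exact hBle m hm
      _ = _ := by ring
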